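/- Let $M,N\ge 0$ be integers with $M+N\ge 1$, let $\hbar\in\mathbb C\setminus\{0\}$, and let $[i]=0$ for $1\le i\le M$ and $[i]=1$ for $M<i\le M+N$. Let $\mathcal Y(M|N)$ be the super-Yangian: the associative unital $\mathbb C$-algebra generated by $T^{(n)}_{ab}$ ($n\ge 1$, $1\le a,b\le M+N$) with the relations, for all $m,n\ge 0$ and with $T^{(0)}_{ab}=\delta_{ab}$, $$T^{(m)}_{ab}T^{(n)}_{cd}-(-1)^{([a]+[b])([c]+[d])}T^{(n)}_{cd}T^{(m)}_{ab}=(-1)^{[a][b]+[a][c]+[b][c]}\sum_{p=0}^{\min(m,n)-1}\Big(T^{(p)}_{cb}T^{(m+n-1-p)}_{ad}-T^{(m+n-1-p)}_{cb}T^{(p)}_{ad}\Big).$$ Put $T_{ab}(u)=\sum_{n\ge 0}\hbar^n u^{-n}T^{(n)}_{ab}$, let $T(u)=(T_{ab}(u))$, and let $T^{-1}(u)=(T'_{ab}(u))$ be the inverse matrix of formal power series in $u^{-1}$, i.e. $\sum_c T_{ac}(u)T'_{cb}(u)=\delta_{ab}$. Shifted series $f(u+a)$ are expanded in powers of $u^{-1}$.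 There is a unique series $Z(u)\in\mathcal Y(M|N)[[u^{-1}]]$ with central coefficients (the Liouville contraction) such that for all $i,j$ $$\sum_{k}(-1)^{([i]+[k])([k]+[j])}\,T_{kj}(u+\hbar(M-N))\,T'_{ik}(u)=\delta_{ij}Z(u)=\sum_{k}(-1)^{([i]+[k])([k]+[j])}\,T'_{kj}(u)\,T_{ik}(u+\hbar(M-N)).$$ Let $V$ be a $\mathcal Y(M|N)$-module and $v^+\in V$ a highest weight vector of highest weight $(\lambda_1(u),\dots,\lambda_{M+N}(u))$, i.e. $v^+\ne 0$, $T_{aa}(u)v^+=\lambda_a(u)v^+$ with $\lambda_a(u)\in 1+u^{-1}\mathbb C[[u^{-1}]]$ for all $a$, and $T_{ab}(u)v^+=0$ for $b<a$. Then $v^+$ is an eigenvector of (all coefficients of) $Z(u)$ and of $T'_{kk}(u)$ for $k=1,\dots,M+N$. Denoting the eigenvalue of $Z(u)$ on $v^+$ again by $Z(u)$ and that of $T'_{kk}(u)$ by $\lambda'_k(u)$, one has $$\lambda'_k(u)=\begin{cases}\dfrac{\prod_{m=1}^{k-1}\lambda_m(u+\hbar m)}{\prod_{m=1}^{k}\lambda_m(u+\hbar(m-1))},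 & 1\le k\le M,\\[3ex] Z(u)\,\dfrac{\prod_{m=k+1}^{M+N}\lambda_m(u+\hbar(2M-m+1))}{\prod_{m=k}^{M+N}\lambda_m(u+\hbar(2M-m))}, & M+1\le k\le M+N.\end{cases}$$ -/

import Mathlib

open scoped PowerSeries

noncomputable section

namespace SuperYangian

/-- The distinguished `ℤ/2`-grade on the index set `Fin (M + N)`: the first `M` indices are even,
the last `N` are odd. -/
def parity (M N : ℕ) (i : Fin (M + N)) : ℕ := if (i : ℕ) < M then 0 else 1

/-- The symbols `T_{ab}^{(n)}` in the free algebra, whose free generators are the `T_{ab}^{(n)}`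
with `n > 0`, with the convention `T_{ab}^{(0)} = δ_{ab}`. -/
def freeT (M N : ℕ) : ℕ → Fin (M + N) → Fin (M + N) →
    FreeAlgebra ℂ (ℕ × Fin (M + N) × Fin (M + N))
  | 0, a, b => if a = b then 1 else 0
  | n + 1, a, b => FreeAlgebra.ι ℂ (n, a, b)

/-- The defining supercommutation relations of the super-Yangian:
`[T_{ab}^{(m)}, T_{cd}^{(n)}} = (-1)^{[a][b]+[a][c]+[b][c]} ∑_{p=0}^{min(m,n)-1}
(T_{cb}^{(p)} T_{ad}^{(m+n-1-p)} - T_{cb}^{(m+n-1-p)} T_{ad}^{(p)})`. -/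
inductive Rel (M N : ℕ) : FreeAlgebra ℂ (ℕ × Fin (M + N) × Fin (M + N)) →
    FreeAlgebra ℂ (ℕ × Fin (M + N) × Fin (M + N)) → Prop
  | supercomm (m n : ℕ) (a b c d : Fin (M + N)) : Rel M N
      (freeT M N m a b * freeT M N n c d
        - (-1) ^ ((parity M N a + parity M N b) * (parity M N c + parity M N d))
          * (freeT M N n c d * freeT M N m a b))
      ((-1) ^ (parity M N a * parity M N b + parity M N a * parity M N c + parity M N b * parity M N c)
        * ∑ p ∈ Finset.range (min m n),
          (freeT M N p c b * freeT M N (m + n - 1 - p) a d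
            - freeT M N (m + n - 1 - p) c b * freeT M N p a d))

end SuperYangian

/-- The super-Yangian `Y(M|N)` of `gl(M|N)`, as an associative unital `ℂ`-algebra. -/
def SuperYangian (M N : ℕ) : Type := RingQuot (SuperYangian.Rel M N)

namespace SuperYangian

instance (M N : ℕ) : Ring (SuperYangian M N) :=
  inferInstanceAs (Ring (RingQuot (SuperYangian.Rel M N)))

instance (M N : ℕ) : Algebra ℂ (SuperYangian M N) :=
  inferInstanceAs (Algebra ℂ (RingQuot (SuperYangian.Rel M N)))

/-- The quotient map from the free algebra onto `Y(M|N)`. -/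
def mk (M N : ℕ) : FreeAlgebra ℂ (ℕ × Fin (M + N) × Fin (M + N)) →ₐ[ℂ] SuperYangian M N :=
  RingQuot.mkAlgHom ℂ (Rel M N)

/-- The elements `T_{ab}^{(n)}` of `Y(M|N)`; in particular `T_{ab}^{(0)} = δ_{ab}`. -/
def gen (M N n : ℕ) (a b : Fin (M + N)) : SuperYangian M N := mk M N (freeT M N n a b)

/-- Formal series in `u⁻¹` are power series in `X = u⁻¹`. This is the series
`T(u) = ∑_n ħ^n u^{-n} T^{(n)}`, with coefficients in matrices over `Y(M|N)`. -/
def T (M N : ℕ) (ħ : ℂ) :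
    (Matrix (Fin (M + N)) (Fin (M + N)) (SuperYangian M N))⟦X⟧ :=
  PowerSeries.mk fun n => Matrix.of fun a b => ħ ^ n • gen M N n a b

/-- The constant coefficient of `T(u)` is the identity matrix. -/
theorem constantCoeff_T (M N : ℕ) (ħ : ℂ) :
    PowerSeries.constantCoeff (T M N ħ) = 1 := by
  ext a b
  by_cases h : a = b <;> simp [T, gen, freeT, h, Matrix.one_apply]

/-- The inverse series `T⁻¹(u)`. -/
def Tinv (M N : ℕ) (ħ : ℂ) :
    (Matrix (Fin (M + N)) (Fin (M + N)) (SuperYangian M N))⟦X⟧ :=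
  PowerSeries.invOfUnit (T M N ħ) 1

theorem T_mul_Tinv (M N : ℕ) (ħ : ℂ) : T M N ħ * Tinv M N ħ = 1 :=
  PowerSeries.mul_invOfUnit _ _ (by simpa using constantCoeff_T M N ħ)

theorem Tinv_mul_T (M N : ℕ) (ħ : ℂ) : Tinv M N ħ * T M N ħ = 1 :=
  PowerSeries.invOfUnit_mul _ _ (by simpa using constantCoeff_T M N ħ)

/-- The `(a, b)` entry of a matrix-valued series, as a series. -/
def entry {ι A : Type*} [Fintype ι] [DecidableEq ι] [Ring A]
    (F : (Matrix ι ι A)⟦X⟧) (a b : ι) : A⟦X⟧ :=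
  PowerSeries.mk fun n => PowerSeries.coeff n F a b

/-- The shift `f(u) ↦ f(u + a)` of a formal series in `X = u⁻¹`: since
`(u + a)⁻¹ = X (1 + a X)⁻¹`, this replaces `X ^ n` by the expansion of `(X (1 + a X)⁻¹) ^ n`
(which is divisible by `X ^ n`). -/
def shift {A : Type*} [Ring A] [Algebra ℂ A] (a : ℂ) (f : A⟦X⟧) : A⟦X⟧ :=
  PowerSeries.mk fun r => ∑ n ∈ Finset.range (r + 1),
    PowerSeries.coeff r ((PowerSeries.X * (1 + PowerSeries.C a * PowerSeries.X)⁻¹ : ℂ⟦X⟧) ^ n) •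
      PowerSeries.coeff n f

/-- `Z(u)` is the Liouville contraction of `Y(M|N)`: its coefficients are central and, with
`T^*(u)` the graded transpose of `T⁻¹(u)` and `Q` the partially transposed graded permutation,
`Q T₁(u + ħ(M-N)) T₂^*(u) = T₂^*(u) T₁(u + ħ(M-N)) Q = Z(u) Q`.
The two equalities are written here in components, through the entries `T'_{ab}(u)` of `T⁻¹(u)`:
`∑_k (-1)^{([i]+[k])([k]+[j])} T_{kj}(u + ħ(M-N)) T'_{ik}(u) = δ_{ij} Z(u)` and
`∑_k (-1)^{([i]+[k])([k]+[j])} T'_{kj}(u) T_{ik}(u + ħ(M-N)) = δ_{ij} Z(u)`. -/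
structure IsLiouvilleContraction (M N : ℕ) (ħ : ℂ) (Z : (SuperYangian M N)⟦X⟧) : Prop where
  central : ∀ n : ℕ, PowerSeries.coeff n Z ∈ Subalgebra.center ℂ (SuperYangian M N)
  left : ∀ i j : Fin (M + N),
    ∑ k : Fin (M + N), (-1) ^ ((parity M N i + parity M N k) * (parity M N k + parity M N j)) *
      (shift (ħ * ((M : ℂ) - (N : ℂ))) (entry (T M N ħ) k j) * entry (Tinv M N ħ) i k)
      = if i = j then Z else 0
  right : ∀ i j : Fin (M + N),
    ∑ k : Fin (M + N), (-1) ^ ((parity M N i + parity M N k) * (parity M N k + parity M N j)) *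
      (entry (Tinv M N ħ) k j * shift (ħ * ((M : ℂ) - (N : ℂ))) (entry (T M N ħ) i k))
      = if i = j then Z else 0

section Modules

variable {M N : ℕ} {V : Type*} [AddCommGroup V] [Module ℂ V] [Module (SuperYangian M N) V]

/-- `F(u) v = f(u) v`, coefficientwise in `u⁻¹`: the vector `v` is an eigenvector of all the
coefficients of `F(u)`, with the coefficients of the scalar series `f(u)` as eigenvalues. -/
def ActsBy (F : (SuperYangian M N)⟦X⟧) (v : V) (f : ℂ⟦X⟧) : Prop :=
  ∀ n : ℕ, PowerSeries.coeff n F • v = PowerSeries.coeff n f • v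

/-- `v` is a highest weight vector of highest weight `(λ_1(u), …, λ_{M+N}(u))`: it is nonzero,
`T_{aa}(u) v = λ_a(u) v` with `λ_a(u)` a series in `u⁻¹` of constant term `1`, and
`T_{ab}(u) v = 0` for `b < a`. -/
structure IsHighestWeightVector (ħ : ℂ) (v : V) (lam : Fin (M + N) → ℂ⟦X⟧) : Prop where
  ne_zero : v ≠ 0
  constantCoeff : ∀ a, PowerSeries.constantCoeff (lam a) = 1
  diagonal : ∀ a, ActsBy (entry (T M N ħ) a a) v (lam a)
  lower : ∀ a b, b < a → ActsBy (entry (T M N ħ) a b) v 0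

end Modules

end SuperYangian

end

/-! The RTT relation at two points differing by a number `c`, multiplied on both sides by T⁻¹, gives
`c` times the supercommutator of T(u+c) and T⁻¹(u) as `ħ` times entries of T(u+c)T⁻¹(u) and
T⁻¹(u)T(u+c). Summing it over an index yields identities of the shape `c • G c = (c - e) • H c`,
where `H` is built from these two products and is known at `c = 0`, since both are then the
identity. Setting `c = e` determines `G e`. If `e = 0` the factors are equal, so `G` and `H` agree
for `c ≠ 0`, and continuity of every coefficient in `c` gives `G 0 = H 0`. This principle is
`WeaklyContinuous.coeff_mem_of_smul_sub`, also used modulo a subspace.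

For the signed contractions, `e = ħ (M - N)` comes from the superdimension. Off-diagonal
contractions vanish and all diagonal ones agree, left and right; their common value is Z. To see
that Z is central, write it as the contraction at `(j, j)` with `j ≠ a` and apply the Leibniz rule
to its commutator with T_{ab}(v). The result dies after multiplication by cancellable factors, v - u
and v - u - ħ(M - N) up to powers of u and v.

On a highest weight vector one works modulo the left ideal annihilating it. Triangularity leaves
only summation indices up to `k`, so `e = ħ d_k` with `d_k` the partial superdimension before `k`.
This shows by induction that the lower entries of T⁻¹ kill the vector and that its diagonal entries
act by scalars. For neighbours `k` and `l = k + 1` it gives λ'_l(u) λ_l(u + ħ d_l) = λ'_k(u) λ_k(u +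
ħ d_l) (`mul_shift_succ`). The recursion starts from λ'_1 λ_1 = 1 for even indices, and for odd ones
runs downwards from the last index, where Z(u) = λ'(u) λ(u + ħ(M - N)). -/

noncomputable section

namespace SuperYangian

/-! ### Abstract super RTT relation, its inverse form and contractions -/

section SuperRTT

variable {K B ι : Type*} [CommRing K] [Ring B] [Algebra K B] [Fintype ι] [DecidableEq ι]

/-- The super RTT relation `e [T_{ab}, S_{cd}} = f (-1)^{[a][b]+[a][c]+[b][c]}
(T_{cb} S_{ad} - S_{cb} T_{ad})`, where `e` plays the role of `u - v` and `f` that of `ħ`. -/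
def SuperRTT (p : ι → ℕ) (e f : K) (T S : Matrix ι ι B) : Prop :=
  ∀ a b c d, e • (T a b * S c d - (-1 : K) ^ ((p a + p b) * (p c + p d)) • (S c d * T a b)) =
    (f * (-1) ^ (p a * p b + p a * p c + p b * p c)) • (T c b * S a d - S c b * T a d)

/-- The relation satisfied by `T` and the inverse `S'` of `S` when `T`, `S` satisfy the super RTT
relation. -/
def SuperRTTInv (p : ι → ℕ) (e f : K) (T S' : Matrix ι ι B) : Prop :=
  ∀ a b c d, e • (T a b * S' c d - (-1 : K) ^ ((p a + p b) * (p c + p d)) • (S' c d * T a b)) =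
    (f * (-1) ^ (p a * p b + p a * p c + p b * p c)) •
      ((if b = c then (T * S') a d else 0) - if a = d then (S' * T) c b else 0)

omit [Fintype ι] [DecidableEq ι] in
theorem neg_one_pow_smul (n : ℕ) (x : B) : (-1 : K) ^ n • x = (-1 : B) ^ n * x := by
  rcases Nat.even_or_odd n with h | h <;> simp [h.neg_one_pow]

/-- For fixed `a`, `b` the relation is a matrix identity in the remaining indices. The diagonal
matrix `D` absorbs the signs, and the right side is a difference of rank-one matrices. Multiplying
by `D * S' * D` on the left and `S'` on the right removes `S`. -/
theorem SuperRTT.inv {p : ι → ℕ} {e f : K} {T S S' : Matrix ι ι B}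
    (h : SuperRTT p e f T S) (h₁ : S * S' = 1) (h₂ : S' * S = 1) : SuperRTTInv p e f T S' := by
  intro a b c d
  set D : Matrix ι ι B := Matrix.diagonal fun i => (-1) ^ ((p a + p b) * p i) with hD
  set τ : Matrix ι ι B := Matrix.diagonal fun _ => T a b with hτ
  have hDD : D * D = 1 := by
    rw [hD, Matrix.diagonal_mul_diagonal, ← Matrix.diagonal_one]
    congr 1
    ext i
    rw [← pow_add, ← two_mul, pow_mul, neg_one_sq, one_pow]
  have key : e • (τ * S - D * S * D * τ) = (f * (-1) ^ (p a * p b)) •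
      (D * (Matrix.vecMulVec (fun i => T i b) (fun j => S a j)
        - Matrix.vecMulVec (fun i => S i b) (fun j => T a j))) := by
    ext i j
    have := h a b i j
    simp only [neg_one_pow_smul] at this
    simp only [hD, hτ, Matrix.smul_apply, Matrix.sub_apply, Matrix.diagonal_mul,
      Matrix.mul_diagonal, Matrix.vecMulVec_apply]
    have h1 : (-1 : B) ^ ((p a + p b) * p i) * S i j * (-1) ^ ((p a + p b) * p j) * T a b =
        (-1 : B) ^ ((p a + p b) * (p i + p j)) * (S i j * T a b) := by
      rw [mul_add, pow_add, mul_assoc, mul_assoc, mul_assoc,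
        ((Commute.neg_one_left (S i j)).pow_left ((p a + p b) * p j)).left_comm]
    have h2 : p a * p b + p a * p i + p b * p i = p a * p b + (p a + p b) * p i := by ring
    rw [h1, this, h2, pow_add, ← mul_assoc, mul_smul, neg_one_pow_smul]
  have key2 := congrArg (fun X => (D * S' * D * X * S') c d) key
  have hl : D * S' * D * (τ * S - D * S * D * τ) * S' = D * S' * D * τ - τ * S' := by
    have e1 : D * S' * D * (τ * S) * S' = D * S' * D * τ := by
      rw [mul_assoc, mul_assoc τ, h₁, mul_one]
    have e2 : D * S' * D * (D * S * D * τ) * S' = τ * S' := by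
      calc D * S' * D * (D * S * D * τ) * S' = D * S' * (D * D) * S * (D * τ) * S' := by noncomm_ring
        _ = D * (S' * S) * (D * τ) * S' := by rw [hDD]; noncomm_ring
        _ = (D * D) * τ * S' := by rw [h₂]; noncomm_ring
        _ = τ * S' := by rw [hDD, one_mul]
    rw [mul_sub, sub_mul, e1, e2]
  have hr (X : Matrix ι ι B) : D * S' * D * (D * X) * S' = D * (S' * X * S') := by
    calc D * S' * D * (D * X) * S' = D * S' * (D * D) * X * S' := by noncomm_ring
      _ = D * (S' * X * S') := by rw [hDD]; noncomm_ring
  have hv1 : S'.mulVec (fun i => T i b) = fun i => (S' * T) i b := rfl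
  have hv2 : Matrix.vecMul (fun j => S a j) S' = fun j => (S * S') a j := rfl
  have hv3 : S'.mulVec (fun i => S i b) = fun i => (S' * S) i b := rfl
  have hv4 : Matrix.vecMul (fun j => T a j) S' = fun j => (T * S') a j := rfl
  simp only [mul_smul_comm, smul_mul_assoc] at key2
  rw [hl, hr, mul_sub, sub_mul, Matrix.mul_vecMulVec, Matrix.vecMulVec_mul, Matrix.mul_vecMulVec,
    Matrix.vecMulVec_mul, hv1, hv2, hv3, hv4, h₁, h₂] at key2
  simp only [hD, hτ, Matrix.smul_apply, Matrix.sub_apply, Matrix.diagonal_mul,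
      Matrix.mul_diagonal, Matrix.vecMulVec_apply, Matrix.one_apply, mul_ite, ite_mul, mul_one,
      one_mul, mul_zero, zero_mul] at key2
  have h1 : (-1 : B) ^ ((p a + p b) * p c) * S' c d * (-1) ^ ((p a + p b) * p d) * T a b =
      (-1 : K) ^ ((p a + p b) * (p c + p d)) • (S' c d * T a b) := by
    rw [neg_one_pow_smul, mul_add, pow_add, mul_assoc, mul_assoc, mul_assoc,
      ((Commute.neg_one_left (S' c d)).pow_left ((p a + p b) * p d)).left_comm]
  have h2 : p a * p b + p a * p c + p b * p c = p a * p b + (p a + p b) * p c := by ring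
  rw [h1, ← neg_sub, smul_neg, neg_eq_iff_eq_neg] at key2
  rw [key2, h2, pow_add, ← mul_assoc, mul_smul (f * _), neg_one_pow_smul ((p a + p b) * p c),
    ← smul_neg, ← mul_neg, neg_sub]
  simp only [eq_comm]

theorem neg_one_pow_eq_of_even_iff {R : Type*} [Ring R] {m n : ℕ} (h : Even m ↔ Even n) :
    (-1 : R) ^ m = (-1) ^ n := by
  by_cases hm : Even m
  · rw [hm.neg_one_pow, (h.1 hm).neg_one_pow]
  · rw [(Nat.not_even_iff_odd.1 hm).neg_one_pow,
      (Nat.not_even_iff_odd.1 (mt h.2 hm)).neg_one_pow]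

/-- The signed contraction `∑_k (-1)^{([i]+[k])([k]+[j])} T_{kj} S'_{ik}`. -/
def leftContraction (p : ι → ℕ) (T S' : Matrix ι ι B) (i j : ι) : B :=
  ∑ k, (-1) ^ ((p i + p k) * (p k + p j)) * (T k j * S' i k)

/-- The signed contraction `∑_k (-1)^{([i]+[k])([k]+[j])} S'_{kj} T_{ik}`. -/
def rightContraction (p : ι → ℕ) (T S' : Matrix ι ι B) (i j : ι) : B :=
  ∑ k, (-1) ^ ((p i + p k) * (p k + p j)) * (S' k j * T i k)

/-- The supertrace of a matrix. -/
def supertrace (p : ι → ℕ) (X : Matrix ι ι B) : B := ∑ k, (-1) ^ p k * X k k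

variable (K) in
/-- The superdimension, i.e. the supertrace of the identity matrix. -/
def superdim (p : ι → ℕ) : K := ∑ k, (-1) ^ p k

/-- Exchanging the two factors of each summand cancels its sign and produces an entry of `S' * T`.
The correction terms sum to the superdimension times that entry and to a supertrace. -/
theorem SuperRTTInv.smul_leftContraction {p : ι → ℕ} {e f : K} {T S' : Matrix ι ι B}
    (h : SuperRTTInv p e f T S') (i j : ι) :
    e • leftContraction p T S' i j = (e - f * superdim K p) • (S' * T) i j
      + f • (if i = j then supertrace p (T * S') else 0) := by
  have hk (k : ι) : e • ((-1 : B) ^ ((p i + p k) * (p k + p j)) * (T k j * S' i k)) =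
      e • (S' i k * T k j) + f • (if i = j then (-1 : B) ^ p k * (T * S') k k else 0)
        - (f * (-1) ^ p k) • (S' * T) i j := by
    have h1 := h k j i k
    have e1 : (-1 : K) ^ ((p i + p k) * (p k + p j)) * (-1) ^ ((p i + p k) * (p k + p j)) = 1 := by
      rw [← mul_pow]; simp
    have e2 : (-1 : K) ^ ((p i + p k) * (p k + p j)) *
        (-1) ^ (p k * p j + p k * p i + p j * p i) = (-1) ^ p k := by
      rw [← pow_add]
      apply neg_one_pow_eq_of_even_iff
      simp only [Nat.even_add, Nat.even_mul]
      tauto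
    rw [mul_comm (p k + p j), if_pos rfl] at h1
    rw [← neg_one_pow_smul (K := K) (B := B)]
    generalize (-1 : K) ^ ((p i + p k) * (p k + p j)) = ε at *
    have h2 : e • ε • (T k j * S' i k) =
        ε • (e • (T k j * S' i k - ε • (S' i k * T k j))) + (ε * ε) • e • (S' i k * T k j) := by
      module
    rw [h2, h1, e1, ← e2]
    split_ifs with h3 h4 h4
    · rw [← neg_one_pow_smul (K := K) (B := B), ← e2]
      module
    · exact absurd h3.symm h4
    · exact absurd h4.symm h3
    · module
  rw [leftContraction, Finset.smul_sum, Finset.sum_congr rfl fun k _ => hk k,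
    Finset.sum_sub_distrib, Finset.sum_add_distrib, ← Finset.smul_sum, ← Finset.smul_sum,
    ← Finset.sum_smul, ← Finset.mul_sum, ← Matrix.mul_apply, superdim, supertrace]
  split_ifs
  · module
  · rw [Finset.sum_const_zero]
    module

theorem SuperRTTInv.smul_rightContraction {p : ι → ℕ} {e f : K} {T S' : Matrix ι ι B}
    (h : SuperRTTInv p e f T S') (i j : ι) :
    e • rightContraction p T S' i j = (e - f * superdim K p) • (T * S') i j
      + f • (if i = j then supertrace p (S' * T) else 0) := by
  have hk (k : ι) : e • ((-1 : B) ^ ((p i + p k) * (p k + p j)) * (S' k j * T i k)) =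
      e • (T i k * S' k j) + f • (if i = j then (-1 : B) ^ p k * (S' * T) k k else 0)
        - (f * (-1) ^ p k) • (T * S') i j := by
    have h1 := h i k k j
    have e2 : (-1 : K) ^ (p i * p k + p i * p k + p k * p k) = (-1) ^ p k := by
      apply neg_one_pow_eq_of_even_iff
      simp only [Nat.even_add, Nat.even_mul]
      tauto
    simp only [e2, if_true] at h1
    rw [← neg_one_pow_smul (K := K)]
    rw [smul_sub, sub_eq_iff_eq_add', ← sub_eq_iff_eq_add] at h1
    rw [← h1]
    split_ifs with hij
    · rw [← neg_one_pow_smul (K := K)]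
      module
    · module
  rw [rightContraction, Finset.smul_sum, Finset.sum_congr rfl fun k _ => hk k,
    Finset.sum_sub_distrib, Finset.sum_add_distrib, ← Finset.smul_sum, ← Finset.smul_sum,
    ← Finset.sum_smul, ← Finset.mul_sum, ← Matrix.mul_apply, superdim, supertrace]
  split_ifs
  · module
  · rw [Finset.sum_const_zero]
    module

/-- The supertrace of the left contractions is itself the supertrace of `T * S'`, so summing
`smul_leftContraction` over the diagonal relates the two supertraces. -/
theorem SuperRTTInv.smul_supertrace_sub {p : ι → ℕ} {e f : K} {T S' : Matrix ι ι B}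
    (h : SuperRTTInv p e f T S') :
    (e - f * superdim K p) • (supertrace p (T * S') - supertrace p (S' * T)) = 0 := by
  have h1 : ∑ i, (-1) ^ p i * leftContraction p T S' i i = supertrace p (T * S') := by
    simp only [leftContraction, supertrace, Finset.mul_sum, Matrix.mul_apply]
    rw [Finset.sum_comm]
    refine Finset.sum_congr rfl fun k _ => Finset.sum_congr rfl fun i _ => ?_
    rw [← mul_assoc, ← pow_add]
    congr 1
    apply neg_one_pow_eq_of_even_iff
    simp only [Nat.even_add, Nat.even_mul]
    tauto
  have h2 : e • supertrace p (T * S') = (e - f * superdim K p) • supertrace p (S' * T)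
      + (f * superdim K p) • supertrace p (T * S') := by
    rw [← h1, Finset.smul_sum]
    have (i : ι) : e • ((-1) ^ p i * leftContraction p T S' i i) =
        (e - f * superdim K p) • ((-1) ^ p i * (S' * T) i i)
          + (f * (-1) ^ p i) • supertrace p (T * S') := by
      have := h.smul_leftContraction i i
      rw [if_pos rfl] at this
      rw [← mul_smul_comm, this, mul_add, mul_smul_comm, mul_smul_comm, mul_smul,
        neg_one_pow_smul]
    rw [Finset.sum_congr rfl fun i _ => this i, Finset.sum_add_distrib, ← Finset.smul_sum,
      ← Finset.sum_smul, ← Finset.mul_sum, h1]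
    rfl
  rw [sub_smul, smul_sub, smul_sub, h2]
  module

/-- If the right contraction of `W` with `S'` is a scalar matrix `Z`, and `e₁`, `e₂` differ by the
appropriate multiple of the superdimension, then `T` commutes with `Z` up to `e₁ e₂`. -/
theorem smul_commutator_contraction_eq_zero {p : ι → ℕ} {e₁ f₁ e₂ f₂ : K}
    {T S' W : Matrix ι ι B} {Z : B} (h : SuperRTTInv p e₁ f₁ T S')
    (hW : ∀ a b c d, e₂ • (T a b * W c d - (-1 : K) ^ ((p a + p b) * (p c + p d)) • (W c d * T a b))
      = (f₂ * (-1) ^ (p b * p c + p b * p d + p c * p d)) • (W a d * T c b - T a d * W c b))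
    (hZ : ∀ i j, rightContraction p W S' i j = if i = j then Z else 0)
    (hef : e₂ * f₁ = f₂ * (e₁ - f₁ * superdim K p)) {a j : ι} (haj : a ≠ j) (b : ι) :
    (e₁ * e₂) • (T a b * Z - Z * T a b) = 0 := by
  have hZj : Z = rightContraction p W S' j j := by rw [hZ, if_pos rfl]
  -- Super Leibniz rule on each product `S' k j * W j k`; the signs multiply to 1 because the
  -- product has even total degree.
  have hsplit : T a b * Z - Z * T a b =
      ∑ k, (-1 : K) ^ ((p j + p k) * (p k + p j)) • ((T a b * S' k j
        - (-1 : K) ^ ((p a + p b) * (p k + p j)) • (S' k j * T a b)) * W j k)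
      + ∑ k, ((-1 : K) ^ ((p j + p k) * (p k + p j)) * (-1 : K) ^ ((p a + p b) * (p k + p j))) •
        (S' k j * (T a b * W j k - (-1 : K) ^ ((p a + p b) * (p j + p k)) • (W j k * T a b))) := by
    rw [hZj, rightContraction, Finset.mul_sum, Finset.sum_mul, ← Finset.sum_sub_distrib,
      ← Finset.sum_add_distrib]
    refine Finset.sum_congr rfl fun k _ => ?_
    have e1 : (-1 : K) ^ ((p a + p b) * (p k + p j)) * (-1) ^ ((p a + p b) * (p j + p k)) = 1 := by
      rw [add_comm (p j), ← mul_pow]; simp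
    have e2 : ((-1 : K) ^ ((p j + p k) * (p k + p j)) * (-1 : K) ^ ((p a + p b) * (p k + p j))) •
        (-1 : K) ^ ((p a + p b) * (p j + p k)) • (S' k j * (W j k * T a b)) =
        (-1 : K) ^ ((p j + p k) * (p k + p j)) • (S' k j * (W j k * T a b)) := by
      rw [smul_smul, mul_assoc, e1, mul_one]
    rw [← neg_one_pow_smul (K := K) (B := B)]
    simp only [mul_smul_comm, smul_mul_assoc, sub_mul, mul_sub, smul_sub, mul_assoc, e2]
    module
  have hA : e₁ • ∑ k, (-1 : K) ^ ((p j + p k) * (p k + p j)) • ((T a b * S' k j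
        - (-1 : K) ^ ((p a + p b) * (p k + p j)) • (S' k j * T a b)) * W j k) =
      (f₁ * (-1) ^ (p j + p j * p b + p j * p b)) • ((T * S') a j * W j b) := by
    -- The choice `a ≠ j` removes one Kronecker delta, and the other selects `k = b`.
    rw [Finset.smul_sum, Finset.sum_eq_single b]
    · rw [smul_comm, ← smul_mul_assoc, h, if_pos rfl, if_neg haj, sub_zero, smul_mul_assoc,
        smul_smul, mul_left_comm, ← pow_add]
      congr 2
      apply neg_one_pow_eq_of_even_iff
      simp only [Nat.even_add, Nat.even_mul]
      tauto
    · intro k _ hk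
      rw [smul_comm, ← smul_mul_assoc, h, if_neg (Ne.symm hk), if_neg haj]
      simp
    · simp
  have hB : e₂ • ∑ k, ((-1 : K) ^ ((p j + p k) * (p k + p j)) *
      (-1 : K) ^ ((p a + p b) * (p k + p j))) •
        (S' k j * (T a b * W j k - (-1 : K) ^ ((p a + p b) * (p j + p k)) • (W j k * T a b))) =
      - (f₂ * (-1) ^ (p j + p j * p b + p j * p b)) • (rightContraction p T S' a j * W j b) := by
    have hc : rightContraction p W S' a j = 0 := by rw [hZ, if_neg haj]
    -- The contraction of `W` at `(a, j)` vanishes; it is reinserted so that both sides match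
    -- summand by summand.
    have : - (f₂ * (-1) ^ (p j + p j * p b + p j * p b)) • (rightContraction p T S' a j * W j b) =
        (f₂ * (-1) ^ (p j + p j * p b + p j * p b)) • (rightContraction p W S' a j * T j b
          - rightContraction p T S' a j * W j b) := by
      rw [hc, zero_mul, zero_sub, smul_neg, neg_smul]
    rw [this, rightContraction, rightContraction, Finset.sum_mul, Finset.sum_mul,
      ← Finset.sum_sub_distrib, Finset.smul_sum, Finset.smul_sum]
    refine Finset.sum_congr rfl fun k _ => ?_
    rw [smul_comm, ← mul_smul_comm, hW, ← neg_one_pow_smul (K := K) (B := B),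
      ← neg_one_pow_smul (K := K) (B := B), smul_mul_assoc, smul_mul_assoc, ← smul_sub,
      mul_smul_comm, smul_smul, smul_smul, mul_sub, mul_assoc (S' k j), mul_assoc (S' k j),
      ← pow_add, mul_left_comm, mul_assoc f₂, ← pow_add, ← pow_add]
    refine congrArg₂ (· • ·) (congrArg (f₂ * ·) (neg_one_pow_eq_of_even_iff ?_)) rfl
    simp only [Nat.even_add, Nat.even_mul]
    by_cases h1 : Even (p a) <;> by_cases h2 : Even (p b) <;> by_cases h3 : Even (p j) <;>
      by_cases h4 : Even (p k) <;> simp only [h1, h2, h3, h4, or_true, or_false, true_iff,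
        false_iff, not_true_eq_false]
  have hR := h.smul_rightContraction a j
  rw [if_neg haj, smul_zero, add_zero] at hR
  have hcomb (x y : B) : (e₁ * e₂) • (x + y) = e₂ • (e₁ • x) + e₁ • (e₂ • y) := by module
  rw [hsplit, hcomb, hA, hB, smul_comm e₁, ← smul_mul_assoc e₁, hR, smul_smul, smul_mul_assoc,
    smul_smul, ← add_smul, neg_mul, ← mul_assoc, hef]
  convert zero_smul K _ using 2
  ring

end SuperRTT

/-! ### Double series and substitution for the outer variable -/

section Series

open PowerSeries

variable {R A : Type*} [CommRing R] [Ring A] [Algebra R A]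

theorem map_algebraMap_mul_comm (g : R⟦X⟧) (F : A⟦X⟧) :
    PowerSeries.map (algebraMap R A) g * F = F * PowerSeries.map (algebraMap R A) g := by
  ext n
  rw [coeff_mul, coeff_mul, ← Finset.Nat.sum_antidiagonal_swap]
  simp [Algebra.commutes]

/-- Power series over an `R`-algebra form an algebra over the power series over `R`. -/
@[reducible] def seriesAlgebra (R A : Type*) [CommRing R] [Ring A] [Algebra R A] :
    Algebra R⟦X⟧ A⟦X⟧ :=
  RingHom.toAlgebra' (PowerSeries.map (algebraMap R A)) map_algebraMap_mul_comm

attribute [local instance] seriesAlgebra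

theorem series_smul_def (g : R⟦X⟧) (F : A⟦X⟧) :
    g • F = PowerSeries.map (algebraMap R A) g * F := rfl

theorem X_smul (F : A⟦X⟧) : (X : R⟦X⟧) • F = X * F := by rw [series_smul_def, map_X]

theorem C_smul (r : R) (F : A⟦X⟧) : (C r : R⟦X⟧) • F = r • F := by
  ext n
  rw [series_smul_def, map_C, coeff_C_mul, coeff_smul, Algebra.smul_def]

theorem coeff_smul_C (n : ℕ) (g : R⟦X⟧) (t : A) : coeff n (g • (C t : A⟦X⟧)) = coeff n g • t := by
  rw [series_smul_def, coeff_mul_C, coeff_map, Algebra.smul_def]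

theorem coeff_pow_smul_of_lt {y : R⟦X⟧} (hy : constantCoeff y = 0) {r n : ℕ} (h : r < n)
    (F : A⟦X⟧) : coeff r (y ^ n • F) = 0 := by
  obtain ⟨z, rfl⟩ := X_dvd_iff.2 hy
  rw [mul_pow, mul_smul, series_smul_def, map_pow, map_X, coeff_X_pow_mul', if_neg (by omega)]

/-- The substitution `∑_n F_n v^{-n} ↦ ∑_n F_n y^n` of a series `y` without constant term for
the outer variable of a double series. -/
def spec (y : R⟦X⟧) (G : A⟦X⟧⟦X⟧) : A⟦X⟧ :=
  PowerSeries.mk fun r => coeff r (∑ n ∈ Finset.range (r + 1), y ^ n • coeff n G)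

/-- Since `y ^ n` has no terms below degree `n`, lengthening the truncation does not change the
coefficient. -/
theorem coeff_spec {y : R⟦X⟧} (hy : constantCoeff y = 0) (G : A⟦X⟧⟦X⟧) {r N : ℕ} (h : r < N) :
    coeff r (spec y G) = coeff r (∑ n ∈ Finset.range N, y ^ n • coeff n G) := by
  rw [spec, coeff_mk, map_sum, map_sum]
  refine Finset.sum_subset (Finset.range_mono h) fun n _ hn => ?_
  exact coeff_pow_smul_of_lt hy (by simpa using hn) _

theorem spec_sub (y : R⟦X⟧) (G H : A⟦X⟧⟦X⟧) : spec y (G - H) = spec y G - spec y H := by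
  ext r
  simp [spec, smul_sub, Finset.sum_sub_distrib]

theorem spec_smul (y : R⟦X⟧) (c : R) (G : A⟦X⟧⟦X⟧) : spec y (c • G) = c • spec y G := by
  ext r
  have h (n : ℕ) : y ^ n • c • coeff n G = c • y ^ n • coeff n G := by
    rw [← C_smul, smul_comm, C_smul]
  simp only [spec, coeff_mk, coeff_smul, h, ← Finset.smul_sum]

/-- Compatibility with factors constant in the outer variable, on either side, and with the factor
`X` is all the multiplicativity that the RTT relation requires. -/
theorem spec_C_mul {y : R⟦X⟧} (hy : constantCoeff y = 0) (F : A⟦X⟧) (G : A⟦X⟧⟦X⟧) :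
    spec y (C F * G) = F * spec y G := by
  ext r
  have h1 : coeff r (F * spec y G) =
      coeff r (F * ∑ n ∈ Finset.range (r + 1), y ^ n • coeff n G) := by
    rw [coeff_mul, coeff_mul]
    refine Finset.sum_congr rfl fun ij hij => ?_
    rw [coeff_spec hy G (N := r + 1) (by have := Finset.HasAntidiagonal.mem_antidiagonal.1 hij; omega)]
  rw [h1, coeff_spec hy _ r.lt_succ_self, Finset.mul_sum]
  simp only [coeff_C_mul, mul_smul_comm]

theorem spec_mul_C {y : R⟦X⟧} (hy : constantCoeff y = 0) (F : A⟦X⟧) (G : A⟦X⟧⟦X⟧) :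
    spec y (G * C F) = spec y G * F := by
  ext r
  have h1 : coeff r (spec y G * F) =
      coeff r ((∑ n ∈ Finset.range (r + 1), y ^ n • coeff n G) * F) := by
    rw [coeff_mul, coeff_mul]
    refine Finset.sum_congr rfl fun ij hij => ?_
    rw [coeff_spec hy G (N := r + 1) (by have := Finset.HasAntidiagonal.mem_antidiagonal.1 hij; omega)]
  rw [h1, coeff_spec hy _ r.lt_succ_self, Finset.sum_mul]
  simp only [coeff_mul_C, smul_mul_assoc]

theorem spec_X_mul {y : R⟦X⟧} (hy : constantCoeff y = 0) (G : A⟦X⟧⟦X⟧) :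
    spec y (X * G) = y • spec y G := by
  ext r
  have h1 : coeff r (y • spec y G) =
      coeff r (y • ∑ n ∈ Finset.range (r + 1), y ^ n • coeff n G) := by
    rw [series_smul_def, series_smul_def, coeff_mul, coeff_mul]
    refine Finset.sum_congr rfl fun ij hij => ?_
    rw [coeff_spec hy G (N := r + 1) (by have := Finset.HasAntidiagonal.mem_antidiagonal.1 hij; omega)]
  rw [h1, coeff_spec hy _ (N := r + 2) (by omega), Finset.sum_range_succ', Finset.smul_sum]
  simp only [coeff_succ_X_mul, smul_smul, pow_succ']
  simp

theorem spec_X_smul {y : R⟦X⟧} (hy : constantCoeff y = 0) (G : A⟦X⟧⟦X⟧) :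
    spec y ((X : R⟦X⟧⟦X⟧) • G) = y • spec y G := by
  rw [X_smul, spec_X_mul hy]

theorem spec_C_smul {y : R⟦X⟧} (hy : constantCoeff y = 0) (g : R⟦X⟧) (G : A⟦X⟧⟦X⟧) :
    spec y ((C g : R⟦X⟧⟦X⟧) • G) = g • spec y G := by
  rw [series_smul_def, map_C, spec_C_mul hy]
  rfl

end Series

/-! ### Shifts and their continuity in the shift parameter -/

section Shift

open PowerSeries

attribute [local instance] seriesAlgebra

variable {A : Type*} [Ring A] [Algebra ℂ A]

/-- The expansion of `(u + a)⁻¹` in powers of `u⁻¹`. -/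
def shiftX (a : ℂ) : ℂ⟦X⟧ := PowerSeries.X * (1 + PowerSeries.C a * PowerSeries.X)⁻¹

theorem constantCoeff_shiftX (a : ℂ) : constantCoeff (shiftX a) = 0 := by simp [shiftX]

theorem shiftX_mul (a : ℂ) : shiftX a * (1 + C a * X) = X := by
  rw [shiftX, mul_assoc, PowerSeries.inv_mul_cancel _ (by simp), mul_one]

theorem shift_eq_spec (a : ℂ) (f : A⟦X⟧) : shift a f = spec (shiftX a) (PowerSeries.map C f) := by
  ext r
  simp only [shift, spec, coeff_mk, map_sum, coeff_map]
  exact Finset.sum_congr rfl fun n _ => (coeff_smul_C r _ _).symm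

theorem shift_zero (f : A⟦X⟧) : shift 0 f = f := by
  ext r
  simp [shift, coeff_X_pow]

theorem shift_sub (a : ℂ) (f g : A⟦X⟧) : shift a (f - g) = shift a f - shift a g := by
  rw [shift_eq_spec, map_sub, spec_sub, ← shift_eq_spec, ← shift_eq_spec]

theorem shift_smul (a c : ℂ) (f : A⟦X⟧) : shift a (c • f) = c • shift a f := by
  ext r
  simp only [shift, coeff_mk, coeff_smul, Finset.smul_sum]
  exact Finset.sum_congr rfl fun n _ => smul_comm _ _ _

theorem shift_C_mul (a : ℂ) (t : A) (f : A⟦X⟧) : shift a (C t * f) = C t * shift a f := by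
  rw [shift_eq_spec, map_mul, map_C, spec_C_mul (constantCoeff_shiftX a), ← shift_eq_spec]

theorem shift_mul_C (a : ℂ) (t : A) (f : A⟦X⟧) : shift a (f * C t) = shift a f * C t := by
  rw [shift_eq_spec, map_mul, map_C, spec_mul_C (constantCoeff_shiftX a), ← shift_eq_spec]

theorem shift_X_mul (a : ℂ) (f : A⟦X⟧) : shift a (X * f) = shiftX a • shift a f := by
  rw [shift_eq_spec, map_mul, map_X, spec_X_mul (constantCoeff_shiftX a), ← shift_eq_spec]

theorem constantCoeff_shift (a : ℂ) (f : A⟦X⟧) :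
    constantCoeff (shift a f) = constantCoeff f := by
  rw [← coeff_zero_eq_constantCoeff_apply, shift, coeff_mk]
  simp

/-- By the geometric series, (u + a)⁻¹ has coefficients that are polynomials in `a`. -/
theorem continuous_coeff_shiftX_pow (n r : ℕ) : Continuous fun a => coeff r (shiftX a ^ n) := by
  have hx (a : ℂ) : shiftX a = X * PowerSeries.mk fun k => (-a) ^ k := by
    have h : (1 + C a * X) * (PowerSeries.mk fun k => (-a) ^ k) = 1 := by
      ext (_ | k)
      · simp
      · rw [add_mul, one_mul, mul_assoc, map_add, coeff_C_mul, coeff_succ_X_mul, coeff_mk, coeff_mk,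
          coeff_one]
        simp [pow_succ, mul_comm]
    rw [shiftX, ← (PowerSeries.eq_inv_iff_mul_eq_one (by simp)).2 ((mul_comm _ _).trans h)]
  induction n generalizing r with
  | zero => simpa using continuous_const
  | succ n ih =>
    simp only [pow_succ, coeff_mul]
    refine continuous_finsetSum _ fun ij _ => (ih _).mul ?_
    simp only [hx]
    rcases ij.2 with _ | k
    · simpa using continuous_const
    · simp only [coeff_succ_X_mul, coeff_mk]
      fun_prop

/-- A family of series depending continuously on a complex parameter, tested by linear forms on
each coefficient. -/
def WeaklyContinuous (F : ℂ → A⟦X⟧) : Prop :=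
  ∀ (r : ℕ) (φ : A →ₗ[ℂ] ℂ), Continuous fun c => φ (coeff r (F c))

namespace WeaklyContinuous

theorem sub {F G : ℂ → A⟦X⟧} (hF : WeaklyContinuous F) (hG : WeaklyContinuous G) :
    WeaklyContinuous fun c => F c - G c := fun r φ => by
  simp only [map_sub]
  exact (hF r φ).sub (hG r φ)

theorem sum {ι : Type*} {s : Finset ι} {F : ι → ℂ → A⟦X⟧}
    (hF : ∀ i ∈ s, WeaklyContinuous (F i)) : WeaklyContinuous fun c => ∑ i ∈ s, F i c :=
  fun r φ => by
    simpa using continuous_finsetSum s fun i hi => hF i hi r φ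

theorem const_mul (G : A⟦X⟧) {F : ℂ → A⟦X⟧} (hF : WeaklyContinuous F) :
    WeaklyContinuous fun c => G * F c := fun r φ => by
  simp only [coeff_mul, map_sum]
  exact continuous_finsetSum _ fun ij _ => hF ij.2 (φ ∘ₗ LinearMap.mulLeft ℂ (coeff ij.1 G))

theorem mul_const (G : A⟦X⟧) {F : ℂ → A⟦X⟧} (hF : WeaklyContinuous F) :
    WeaklyContinuous fun c => F c * G := fun r φ => by
  simp only [coeff_mul, map_sum]
  exact continuous_finsetSum _ fun ij _ => hF ij.1 (φ ∘ₗ LinearMap.mulRight ℂ (coeff ij.2 G))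

theorem shift (f : A⟦X⟧) : WeaklyContinuous fun c => shift c f := fun r φ => by
  simp only [SuperYangian.shift, coeff_mk, map_sum, map_smul, smul_eq_mul]
  exact continuous_finsetSum _ fun n _ => (continuous_coeff_shiftX_pow n r).mul continuous_const

/-- A weakly continuous family that lies coefficientwise in a subspace away from one value of the
parameter also does so at this value. -/
theorem coeff_mem {F : ℂ → A⟦X⟧} (hF : WeaklyContinuous F) {S : Submodule ℂ A} {c₀ : ℂ}
    (h : ∀ c ≠ c₀, ∀ r, coeff r (F c) ∈ S) (r : ℕ) : coeff r (F c₀) ∈ S := by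
  by_contra hmem
  obtain ⟨φ, hφ, hle⟩ := Submodule.exists_le_ker_of_notMem hmem
  refine hφ ?_
  have hcl : IsClosed {c | φ (coeff r (F c)) = 0} := isClosed_singleton.preimage (hF r φ)
  have hd : Dense ({c₀}ᶜ : Set ℂ) := dense_compl_singleton c₀
  exact hcl.closure_subset_iff.2 (fun c hc => hle (h c hc r)) (hd c₀)

/-- If `c G(c) - (c - e) H(c)` lies coefficientwise in a subspace for all `c`, and so does `H(0)`,
then so does `G(e)`. -/
theorem coeff_mem_of_smul_sub {G H : ℂ → A⟦X⟧} (hG : WeaklyContinuous G) (hH : WeaklyContinuous H)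
    {S : Submodule ℂ A} {e : ℂ} (h : ∀ c r, coeff r (c • G c - (c - e) • H c) ∈ S)
    (h0 : ∀ r, coeff r (H 0) ∈ S) (r : ℕ) : coeff r (G e) ∈ S := by
  -- For `e = 0` the common factor `c` cancels away from 0, and continuity extends the conclusion
  -- about `G c - H c` to 0.
  by_cases he : e = 0
  · subst he
    have h1 : coeff r ((fun c => G c - H c) 0) ∈ S := by
      refine (hG.sub hH).coeff_mem (fun c hc r => ?_) r
      have := h c r
      rw [sub_zero, ← smul_sub, coeff_smul] at this
      exact (Submodule.smul_mem_iff S hc).1 this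
    have := S.add_mem h1 (h0 r)
    rwa [← map_add, sub_add_cancel] at this
  · have := h e r
    rw [sub_self, zero_smul, sub_zero, coeff_smul] at this
    exact (Submodule.smul_mem_iff S he).1 this

end WeaklyContinuous

end Shift

/-! ### Defining relations as recurrences -/

open PowerSeries

variable {M N : ℕ}

/-- The supercommutator `[T_{ab}^{(m)}, T_{cd}^{(n)}}`. -/
def genBracket (M N m n : ℕ) (a b c d : Fin (M + N)) : SuperYangian M N :=
  gen M N m a b * gen M N n c d - (-1 : ℂ) ^ ((parity M N a + parity M N b) *
    (parity M N c + parity M N d)) • (gen M N n c d * gen M N m a b)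

theorem genBracket_eq (m n : ℕ) (a b c d : Fin (M + N)) :
    genBracket M N m n a b c d = (-1 : ℂ) ^ (parity M N a * parity M N b
      + parity M N a * parity M N c + parity M N b * parity M N c) •
        ∑ p ∈ Finset.range (min m n), (gen M N p c b * gen M N (m + n - 1 - p) a d
          - gen M N (m + n - 1 - p) c b * gen M N p a d) := by
  have h := RingQuot.mkAlgHom_rel ℂ (Rel.supercomm m n a b c d)
  simp only [map_sub, map_mul, map_pow, map_neg, map_one, map_sum] at h
  rw [genBracket, neg_one_pow_smul, neg_one_pow_smul]
  exact h

theorem genBracket_swap (m n : ℕ) (a b c d : Fin (M + N)) :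
    genBracket M N m n a b c d = -((-1 : ℂ) ^ ((parity M N a + parity M N b) *
      (parity M N c + parity M N d)) • genBracket M N n m c d a b) := by
  have e : (-1 : ℂ) ^ ((parity M N a + parity M N b) * (parity M N c + parity M N d)) *
      (-1) ^ ((parity M N a + parity M N b) * (parity M N c + parity M N d)) = 1 := by
    rw [← mul_pow]; simp
  rw [genBracket, genBracket, mul_comm (parity M N c + parity M N d), smul_sub, smul_smul, e,
    one_smul, neg_sub]

theorem genBracket_zero_left (n : ℕ) (a b c d : Fin (M + N)) :
    genBracket M N 0 n a b c d = 0 := by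
  rw [genBracket_eq]; simp

theorem genBracket_zero_right (m : ℕ) (a b c d : Fin (M + N)) :
    genBracket M N m 0 a b c d = 0 := by
  rw [genBracket_eq]; simp

/-- Both brackets sum the same summands, of total degree `m + n`, and their ranges differ in at most
one boundary term. This is the coefficient form of (u - v)[T(u), T(v)}. -/
theorem genBracket_succ_sub (m n : ℕ) (a b c d : Fin (M + N)) :
    genBracket M N (m + 1) n a b c d - genBracket M N m (n + 1) a b c d =
      (-1 : ℂ) ^ (parity M N a * parity M N b + parity M N a * parity M N c
        + parity M N b * parity M N c) •
        (gen M N m c b * gen M N n a d - gen M N n c b * gen M N m a d) := by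
  rw [genBracket_eq, genBracket_eq, ← smul_sub]
  congr 1
  have e : m + 1 + n - 1 = m + n := by omega
  rw [e, show m + (n + 1) - 1 = m + n by omega]
  rcases lt_trichotomy m n with h | rfl | h
  · rw [min_eq_left (by omega), min_eq_left (by omega), Finset.sum_range_succ, add_sub_cancel_left,
      show m + n - m = n by omega]
  · simp
  · rw [min_eq_right (by omega), min_eq_right (by omega), Finset.sum_range_succ,
      sub_add_cancel_left, show m + n - n = m by omega, neg_sub]

/-- Obtained by exchanging the arguments of the bracket. The `a d` factors now stand on the left,
where the centrality argument contracts them with T⁻¹. -/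
theorem genBracket_succ_sub' (m n : ℕ) (a b c d : Fin (M + N)) :
    genBracket M N (m + 1) n a b c d - genBracket M N m (n + 1) a b c d =
      (-1 : ℂ) ^ (parity M N b * parity M N c + parity M N b * parity M N d
        + parity M N c * parity M N d) •
        (gen M N n a d * gen M N m c b - gen M N m a d * gen M N n c b) := by
  have h := genBracket_succ_sub n m c d a b
  rw [genBracket_swap (m + 1), genBracket_swap m, neg_sub_neg, ← smul_sub, h, smul_smul, ← pow_add]
  congr 1
  apply neg_one_pow_eq_of_even_iff
  simp only [Nat.even_add, Nat.even_mul]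
  by_cases ha : Even (parity M N a) <;> by_cases hb : Even (parity M N b) <;>
    by_cases hc : Even (parity M N c) <;> by_cases hd : Even (parity M N d) <;>
    simp only [ha, hb, hc, hd, or_true, or_false, or_self, true_iff, iff_true]

section Entry

variable {ι A : Type*} [Fintype ι] [DecidableEq ι] [Ring A]

theorem entry_one (a b : ι) : entry (1 : (Matrix ι ι A)⟦X⟧) a b = if a = b then 1 else 0 := by
  ext n
  by_cases hn : n = 0
  · subst hn
    rw [entry, coeff_mk, coeff_zero_one, Matrix.one_apply]
    split_ifs <;> simp
  · rw [entry, coeff_mk, coeff_one, if_neg hn]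
    split_ifs <;> simp [coeff_one, hn]

theorem entry_mul (F G : (Matrix ι ι A)⟦X⟧) (a b : ι) :
    entry (F * G) a b = ∑ c, entry F a c * entry G c b := by
  ext n
  simp only [entry, coeff_mk, coeff_mul, map_sum, Matrix.sum_apply, Matrix.mul_apply]
  exact Finset.sum_comm

end Entry

/-! ### RTT relations for T(v), T(u + x) and T(u) -/

section Matrices

attribute [local instance] seriesAlgebra

variable (M N) (ħ : ℂ)

/-- The matrix `T(u)` of series. -/
def tMatrix : Matrix (Fin (M + N)) (Fin (M + N)) (SuperYangian M N)⟦X⟧ :=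
  Matrix.of (entry (T M N ħ))

/-- The matrix `T⁻¹(u)` of series. -/
def tInvMatrix : Matrix (Fin (M + N)) (Fin (M + N)) (SuperYangian M N)⟦X⟧ :=
  Matrix.of (entry (Tinv M N ħ))

/-- The matrix `T(u + a)` of series in `u⁻¹`. -/
def tShift (a : ℂ) : Matrix (Fin (M + N)) (Fin (M + N)) (SuperYangian M N)⟦X⟧ :=
  Matrix.of fun i j => shift a (tMatrix M N ħ i j)

/-- The matrix `T(v)` of double series in `u⁻¹` and `v⁻¹`, the latter being the outer variable. -/
def tOuter : Matrix (Fin (M + N)) (Fin (M + N)) (SuperYangian M N)⟦X⟧⟦X⟧ :=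
  Matrix.of fun i j => PowerSeries.map C (tMatrix M N ħ i j)

theorem coeff_tMatrix (n : ℕ) (a b : Fin (M + N)) :
    coeff n (tMatrix M N ħ a b) = ħ ^ n • gen M N n a b := by
  simp [tMatrix, entry, T]

theorem coeff_tOuter (n : ℕ) (a b : Fin (M + N)) :
    coeff n (tOuter M N ħ a b) = C (ħ ^ n • gen M N n a b) := by
  rw [tOuter, Matrix.of_apply, coeff_map, coeff_tMatrix]

theorem tMatrix_mul_tInvMatrix : tMatrix M N ħ * tInvMatrix M N ħ = 1 := by
  ext1 a b
  rw [Matrix.one_apply, ← entry_one, ← T_mul_Tinv M N ħ, entry_mul]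
  rfl

theorem tInvMatrix_mul_tMatrix : tInvMatrix M N ħ * tMatrix M N ħ = 1 := by
  ext1 a b
  rw [Matrix.one_apply, ← entry_one, ← Tinv_mul_T M N ħ, entry_mul]
  rfl

theorem tShift_zero : tShift M N ħ 0 = tMatrix M N ħ := by
  ext1 a b
  rw [tShift, Matrix.of_apply, shift_zero]

theorem superdim_parity : superdim ℂ (parity M N) = (M : ℂ) - N := by
  rw [superdim, Fin.sum_univ_add]
  simp [parity]
  ring

variable {M N ħ}

/-- The supercommutator of `ħ^n T_{ab}^{(n)}` with a series. -/
def coeffBracket (ħ : ℂ) (W : Matrix (Fin (M + N)) (Fin (M + N)) (SuperYangian M N)⟦X⟧)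
    (a b c d : Fin (M + N)) (n : ℕ) : (SuperYangian M N)⟦X⟧ :=
  C (ħ ^ n • gen M N n a b) * W c d - (-1 : ℂ) ^ ((parity M N a + parity M N b) *
    (parity M N c + parity M N d)) • (W c d * C (ħ ^ n • gen M N n a b))

theorem coeff_coeffBracket (a b c d : Fin (M + N)) (n m : ℕ) :
    coeff m (coeffBracket ħ (tMatrix M N ħ) a b c d n) = ħ ^ (n + m) • genBracket M N n m a b c d := by
  rw [coeffBracket, map_sub, coeff_C_mul, coeff_smul, coeff_mul_C, coeff_tMatrix, genBracket]
  simp only [smul_mul_smul_comm, smul_sub, pow_add]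
  rw [smul_comm, mul_comm (ħ ^ m)]

theorem X_smul_coeffBracket (a b c d : Fin (M + N)) (n : ℕ) :
    (X : ℂ⟦X⟧) • coeffBracket ħ (tMatrix M N ħ) a b c d (n + 1)
        - coeffBracket ħ (tMatrix M N ħ) a b c d n =
      (X : ℂ⟦X⟧) • ((ħ * (-1) ^ (parity M N a * parity M N b + parity M N a * parity M N c
        + parity M N b * parity M N c)) •
        (C (ħ ^ n • gen M N n c b) * tMatrix M N ħ a d
          - tMatrix M N ħ c b * C (ħ ^ n • gen M N n a d))) := by
  ext (_ | m)
  · rw [map_sub, coeff_coeffBracket, X_smul, X_smul, genBracket_zero_right]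
    simp
  · rw [map_sub, coeff_coeffBracket, X_smul, X_smul, coeff_succ_X_mul, coeff_succ_X_mul,
      coeff_coeffBracket, coeff_smul, map_sub, coeff_C_mul, coeff_mul_C, coeff_tMatrix,
      coeff_tMatrix, show n + 1 + m = n + (m + 1) by ring, ← smul_sub, genBracket_succ_sub]
    simp only [smul_mul_smul_comm]
    rw [mul_comm (ħ ^ m), ← smul_sub, smul_smul, smul_smul]
    congr 1
    ring

theorem X_smul_coeffBracket' (a b c d : Fin (M + N)) (n : ℕ) :
    (X : ℂ⟦X⟧) • coeffBracket ħ (tMatrix M N ħ) a b c d (n + 1)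
        - coeffBracket ħ (tMatrix M N ħ) a b c d n =
      (X : ℂ⟦X⟧) • ((ħ * (-1) ^ (parity M N b * parity M N c + parity M N b * parity M N d
        + parity M N c * parity M N d)) •
        (tMatrix M N ħ a d * C (ħ ^ n • gen M N n c b)
          - C (ħ ^ n • gen M N n a d) * tMatrix M N ħ c b)) := by
  ext (_ | m)
  · rw [map_sub, coeff_coeffBracket, X_smul, X_smul, genBracket_zero_right]
    simp
  · rw [map_sub, coeff_coeffBracket, X_smul, X_smul, coeff_succ_X_mul, coeff_succ_X_mul,
      coeff_coeffBracket, coeff_smul, map_sub, coeff_C_mul, coeff_mul_C, coeff_tMatrix,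
      coeff_tMatrix, show n + 1 + m = n + (m + 1) by ring, ← smul_sub, genBracket_succ_sub']
    simp only [smul_mul_smul_comm]
    rw [mul_comm (ħ ^ m), ← smul_sub, smul_smul, smul_smul]
    congr 1
    ring

theorem coeffBracket_zero (a b c d : Fin (M + N)) :
    coeffBracket ħ (tMatrix M N ħ) a b c d 0 = 0 := by
  ext m
  rw [coeff_coeffBracket, genBracket_zero_left, smul_zero, map_zero]

theorem shift_coeffBracket (x a b c d n) :
    shift x (coeffBracket ħ (tMatrix M N ħ) a b c d n) =
      coeffBracket ħ (tShift M N ħ x) a b c d n := by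
  rw [coeffBracket, shift_sub, shift_C_mul, shift_smul, shift_mul_C]
  rfl

theorem shiftX_smul_coeffBracket' (x : ℂ) (a b c d : Fin (M + N)) (n : ℕ) :
    shiftX x • coeffBracket ħ (tShift M N ħ x) a b c d (n + 1)
        - coeffBracket ħ (tShift M N ħ x) a b c d n =
      shiftX x • ((ħ * (-1) ^ (parity M N b * parity M N c + parity M N b * parity M N d
        + parity M N c * parity M N d)) •
        (tShift M N ħ x a d * C (ħ ^ n • gen M N n c b)
          - C (ħ ^ n • gen M N n a d) * tShift M N ħ x c b)) := by
  have h := congrArg (shift x) (X_smul_coeffBracket' (ħ := ħ) a b c d n)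
  rw [X_smul, X_smul, shift_sub, shift_X_mul, shift_X_mul, shift_smul, shift_sub, shift_mul_C,
    shift_C_mul, shift_coeffBracket, shift_coeffBracket] at h
  exact h

/-- With `x` the inverse of u or of its shift and outer `X` = v⁻¹, the factor is u⁻¹ - v⁻¹ = (v -
u)/(uv): the RTT relation multiplied by u⁻¹v⁻¹ to avoid positive powers. -/
theorem smul_mk_of_recurrence {A : Type*} [Ring A] [Algebra ℂ A] {x : ℂ⟦X⟧} {g h : ℕ → A⟦X⟧}
    (h0 : g 0 = 0) (hs : ∀ n, x • g (n + 1) - g n = x • h n) :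
    (C x - X : ℂ⟦X⟧⟦X⟧) • PowerSeries.mk g = (C x * X : ℂ⟦X⟧⟦X⟧) • PowerSeries.mk h := by
  rw [sub_smul, mul_smul, C_smul, C_smul, X_smul, X_smul]
  ext1 (_ | n)
  · simp [h0]
  · rw [map_sub, coeff_smul, coeff_smul, coeff_succ_X_mul, coeff_succ_X_mul]
    simpa using hs n

theorem tOuter_mul_C (a b : Fin (M + N)) (F : (SuperYangian M N)⟦X⟧) :
    tOuter M N ħ a b * C F = PowerSeries.mk fun n => C (ħ ^ n • gen M N n a b) * F := by
  ext1 n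
  rw [coeff_mul_C, coeff_tOuter, coeff_mk]

theorem C_mul_tOuter (a b : Fin (M + N)) (F : (SuperYangian M N)⟦X⟧) :
    C F * tOuter M N ħ a b = PowerSeries.mk fun n => F * C (ħ ^ n • gen M N n a b) := by
  ext1 n
  rw [coeff_C_mul, coeff_tOuter, coeff_mk]

theorem smul_double_series {A : Type*} [Ring A] [Algebra ℂ A] (ħ : ℂ) (y : ℂ⟦X⟧⟦X⟧) (m : ℕ)
    (F : A⟦X⟧⟦X⟧) : (C (C ħ) * y * (-1) ^ m : ℂ⟦X⟧⟦X⟧) • F = y • ((ħ * (-1) ^ m : ℂ) • F) := by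
  rw [mul_assoc, mul_left_comm, mul_smul, mul_smul, mul_smul, neg_one_pow_smul, neg_one_pow_smul,
    C_smul]
  congr 1
  ext1 n
  rw [coeff_smul, coeff_smul, C_smul]

theorem mk_coeffBracket (W : Matrix (Fin (M + N)) (Fin (M + N)) (SuperYangian M N)⟦X⟧)
    (a b c d : Fin (M + N)) : PowerSeries.mk (coeffBracket ħ W a b c d) =
      tOuter M N ħ a b * C (W c d) - (-1 : ℂ) ^ ((parity M N a + parity M N b) *
        (parity M N c + parity M N d)) • (C (W c d) * tOuter M N ħ a b) := by
  rw [tOuter_mul_C, C_mul_tOuter]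
  rfl

/-- The mixed form `ħ (W_{ad} T_{cb}(v) - T_{ad}(v) W_{cb})` of the super RTT relation between
`T(v)` and `W = T(u + x)`. -/
theorem superRTT_tOuter_tShift' (x : ℂ) (a b c d : Fin (M + N)) :
    (C (shiftX x) - X : ℂ⟦X⟧⟦X⟧) • (tOuter M N ħ a b * (tShift M N ħ x).map C c d
      - (-1 : ℂ⟦X⟧⟦X⟧) ^ ((parity M N a + parity M N b) * (parity M N c + parity M N d)) •
        ((tShift M N ħ x).map C c d * tOuter M N ħ a b)) =
    (C (C ħ) * (C (shiftX x) * X) * (-1) ^ (parity M N b * parity M N c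
        + parity M N b * parity M N d + parity M N c * parity M N d) : ℂ⟦X⟧⟦X⟧) •
      ((tShift M N ħ x).map C a d * tOuter M N ħ c b
        - tOuter M N ħ a d * (tShift M N ħ x).map C c b) := by
  have h0 : coeffBracket ħ (tShift M N ħ x) a b c d 0 = 0 := by
    rw [← shift_coeffBracket, coeffBracket_zero, ← zero_smul ℂ 0, shift_smul, zero_smul, zero_smul]
  have h := smul_mk_of_recurrence h0 (shiftX_smul_coeffBracket' x a b c d)
  rw [mk_coeffBracket] at h
  rw [smul_double_series, neg_one_pow_smul, ← neg_one_pow_smul (K := ℂ)]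
  simp only [Matrix.map_apply]
  rw [h, tOuter_mul_C, C_mul_tOuter]
  rfl

theorem X_smul_mk_coeffBracket (a b c d : Fin (M + N)) :
    (C X - X : ℂ⟦X⟧⟦X⟧) • (tOuter M N ħ a b * C (tMatrix M N ħ c d)
      - (-1 : ℂ) ^ ((parity M N a + parity M N b) * (parity M N c + parity M N d)) •
        (C (tMatrix M N ħ c d) * tOuter M N ħ a b)) =
    (C X * X : ℂ⟦X⟧⟦X⟧) • ((ħ * (-1) ^ (parity M N a * parity M N b
        + parity M N a * parity M N c + parity M N b * parity M N c)) •
      (tOuter M N ħ c b * C (tMatrix M N ħ a d) - C (tMatrix M N ħ c b) * tOuter M N ħ a d)) := by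
  have h := smul_mk_of_recurrence (coeffBracket_zero a b c d) (X_smul_coeffBracket (ħ := ħ) a b c d)
  rw [mk_coeffBracket] at h
  rw [h, tOuter_mul_C, C_mul_tOuter]
  rfl

theorem superRTT_tOuter_tMatrix :
    SuperRTT (parity M N) (C X - X : ℂ⟦X⟧⟦X⟧) (C (C ħ) * (C X * X)) (tOuter M N ħ)
      ((tMatrix M N ħ).map C) := by
  intro a b c d
  rw [smul_double_series, neg_one_pow_smul, ← neg_one_pow_smul (K := ℂ)]
  exact X_smul_mk_coeffBracket a b c d

/-- Specialisation v = u + c. The factor u⁻¹ - (u + c)⁻¹ equals c u⁻¹(u + c)⁻¹, and u⁻¹(u + c)⁻¹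
cancels. -/
theorem superRTT_tShift_tMatrix (c : ℂ) :
    SuperRTT (parity M N) c ħ (tShift M N ħ c) (tMatrix M N ħ) := by
  intro i j k l
  have hc := constantCoeff_shiftX c
  have h := congrArg (spec (shiftX c)) (X_smul_mk_coeffBracket (ħ := ħ) i j k l)
  have hT (a b : Fin (M + N)) : spec (shiftX c) (tOuter M N ħ a b) = tShift M N ħ c a b :=
    (shift_eq_spec c _).symm
  rw [sub_smul, mul_smul, spec_sub, spec_C_smul hc, spec_C_smul hc, spec_X_smul hc,
    spec_X_smul hc, spec_sub, spec_mul_C hc, spec_smul, spec_smul, spec_sub, spec_C_mul hc,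
    spec_mul_C hc, spec_C_mul hc, hT, hT, hT, ← sub_smul] at h
  have e : (1 + C c * X) * (X - shiftX c) = X ^ 2 * C c := by
    linear_combination -shiftX_mul c
  -- Multiplying by (u + c)/u turns u⁻¹(u + c)⁻¹ on both sides into `X ^ 2`.
  have h2 := congrArg (fun F => (1 + C c * X : ℂ⟦X⟧) • F) h
  have e' : (1 + C c * X) * (X * shiftX c) = (X ^ 2 : ℂ⟦X⟧) := by
    linear_combination X * shiftX_mul c
  rw [← mul_smul X, ← mul_smul, ← mul_smul, e, e', mul_smul, C_smul, series_smul_def,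
    series_smul_def, map_pow, map_X] at h2
  exact X_pow_mul_cancel h2

end Matrices

/-! ### Centrality of the contraction -/

theorem mem_center_of_commute_gen {z : SuperYangian M N} (h : ∀ n a b, Commute (gen M N n a b) z) :
    z ∈ Subalgebra.center ℂ (SuperYangian M N) := by
  rw [Subalgebra.mem_center_iff]
  intro y
  obtain ⟨x, rfl⟩ : ∃ x, mk M N x = y := RingQuot.mkAlgHom_surjective ℂ (Rel M N) y
  change Commute (mk M N x) z
  induction x using FreeAlgebra.induction with
  | grade0 r =>
    rw [AlgHom.commutes]
    exact Algebra.commutes r z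
  | grade1 x => exact h (x.1 + 1) x.2.1 x.2.2
  | mul x y hx hy =>
    rw [map_mul]
    exact hx.mul_left hy
  | add x y hx hy =>
    rw [map_add]
    exact hx.add_left hy

/-- With a single index the bracket is an ordinary commutator, and the right side is a sum of
commutators involving some degree `p < m`, so induction on `m` applies. -/
theorem commute_gen_of_subsingleton [Subsingleton (Fin (M + N))] (m n : ℕ)
    (a b c d : Fin (M + N)) : Commute (gen M N m a b) (gen M N n c d) := by
  have hb (k l : ℕ) : genBracket M N k l a a a a = gen M N k a a * gen M N l a a
      - gen M N l a a * gen M N k a a := by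
    rw [genBracket, ← two_mul, mul_assoc, pow_mul, neg_one_sq, one_pow, one_smul]
  obtain rfl := Subsingleton.elim a b
  obtain rfl := Subsingleton.elim a c
  obtain rfl := Subsingleton.elim a d
  induction m using Nat.strong_induction_on generalizing n with
  | _ m ih =>
    have h := genBracket_eq m n a a a a
    rw [hb, Finset.sum_eq_zero, smul_zero, sub_eq_zero] at h
    · exact h
    · intro p hp
      rw [sub_eq_zero]
      exact ih p ((Finset.mem_range.1 hp).trans_le (min_le_left _ _)) _

theorem mem_center_of_subsingleton [Subsingleton (Fin (M + N))] (z : SuperYangian M N) :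
    z ∈ Subalgebra.center ℂ (SuperYangian M N) :=
  mem_center_of_commute_gen fun n a b => ((Subalgebra.mem_center_iff.1
    (mem_center_of_commute_gen fun m c d => commute_gen_of_subsingleton m n c d a b)) z).symm

section Central

attribute [local instance] seriesAlgebra

/-- Each outer coefficient, from the lowest up, is annihilated by `x`, which is cancellable because
it divides `X`. -/
theorem eq_zero_of_smul_double_series {R A : Type*} [CommRing R] [Ring A] [Algebra R A]
    {x z : R⟦X⟧} (hz : z * x = X) {G : A⟦X⟧⟦X⟧} (h : (C x - X : R⟦X⟧⟦X⟧) • G = 0) : G = 0 := by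
  have hx {F : A⟦X⟧} (hF : x • F = 0) : F = 0 := by
    have := congrArg (z • ·) hF
    simp only [← mul_smul, hz, smul_zero, X_smul] at this
    exact X_mul_cancel (this.trans (mul_zero _).symm)
  rw [sub_smul, C_smul, X_smul, sub_eq_zero] at h
  ext1 n
  rw [map_zero]
  induction n with
  | zero =>
    have := congrArg (coeff 0) h
    rw [coeff_smul, coeff_zero_X_mul] at this
    exact hx this
  | succ n ih =>
    have := congrArg (coeff (n + 1)) h
    rw [coeff_smul, coeff_succ_X_mul, ih] at this
    exact hx this

theorem map_C_mul_map_C {ι A : Type*} [Fintype ι] [DecidableEq ι] [Ring A] {F G : Matrix ι ι A}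
    (h : F * G = 1) : F.map (C : A →+* A⟦X⟧) * G.map (C : A →+* A⟦X⟧) = 1 := by
  rw [← Matrix.map_mul, h, Matrix.map_one _ (map_zero _) (map_one _)]

theorem coeff_mem_center {ħ : ℂ} (hħ : ħ ≠ 0) {Z : (SuperYangian M N)⟦X⟧}
    (hZ : ∀ i j, rightContraction (parity M N) (tShift M N ħ (ħ * ((M : ℂ) - N)))
      (tInvMatrix M N ħ) i j = if i = j then Z else 0) (n : ℕ) :
    coeff n Z ∈ Subalgebra.center ℂ (SuperYangian M N) := by
  -- The Leibniz argument needs some `j ≠ a`; with one index the algebra is commutative.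
  rcases subsingleton_or_nontrivial (Fin (M + N)) with hs | hs
  · exact mem_center_of_subsingleton _
  refine mem_center_of_commute_gen fun m a b => ?_
  obtain ⟨j, hj⟩ := exists_ne a
  set c₀ := ħ * ((M : ℂ) - N) with hc₀
  have hinv := (superRTT_tOuter_tMatrix (M := M) (N := N) (ħ := ħ)).inv
    (map_C_mul_map_C (tMatrix_mul_tInvMatrix M N ħ)) (map_C_mul_map_C (tInvMatrix_mul_tMatrix M N ħ))
  have hZ' (i j) : rightContraction (parity M N) ((tShift M N ħ c₀).map C)
      ((tInvMatrix M N ħ).map C) i j = if i = j then C Z else 0 := by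
    have := congrArg C (hZ i j)
    rw [apply_ite C, map_zero] at this
    rw [← this, rightContraction, rightContraction]
    simp
  have hd : superdim ℂ⟦X⟧⟦X⟧ (parity M N) = C (C ((M : ℂ) - N)) := by
    rw [← superdim_parity, superdim, superdim]
    simp
  -- This is (u + c₀)⁻¹(1 + c₀u⁻¹) = u⁻¹. It makes the two RTT factors differ by the superdimension,
  -- and here the value of the shift `c₀` is forced.
  have hw : (C (shiftX c₀) * (1 + C (C ħ) * C (C ((M : ℂ) - N)) * C X) : ℂ⟦X⟧⟦X⟧) = C X := by
    conv_rhs => rw [← shiftX_mul c₀, hc₀]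
    simp only [map_mul, map_add, map_one, mul_assoc]
    rw [hc₀]
  have hw' : (1 + C c₀ * X) * shiftX c₀ = X := (mul_comm _ _).trans (shiftX_mul c₀)
  have key := smul_commutator_contraction_eq_zero hinv (superRTT_tOuter_tShift' c₀) hZ'
    (by rw [hd]; linear_combination (C (C ħ) * X ^ 2) * hw) hj.symm b
  rw [mul_smul] at key
  have h := eq_zero_of_smul_double_series hw' (eq_zero_of_smul_double_series (one_mul X) key)
  have h2 := congrArg (fun F => coeff n (coeff m F)) h
  simp only [map_sub, coeff_mul_C, coeff_C_mul, coeff_tOuter, map_zero, smul_mul_assoc,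
    mul_smul_comm, ← smul_sub] at h2
  exact sub_eq_zero.1 ((smul_eq_zero.1 h2).resolve_left (pow_ne_zero _ hħ))

end Central

theorem WeaklyContinuous.eq_zero_of_smul_eq {A : Type*} [Ring A] [Algebra ℂ A] {G H : ℂ → A⟦X⟧}
    (hG : WeaklyContinuous G) (hH : WeaklyContinuous H) {e : ℂ}
    (h : ∀ c, c • G c = (c - e) • H c) (h0 : H 0 = 0) : G e = 0 := by
  ext r
  exact (Submodule.mem_bot ℂ).1 (hG.coeff_mem_of_smul_sub hH (S := ⊥)
    (fun c r => by rw [h, sub_self]; exact map_zero _) (fun r => by rw [h0]; exact map_zero _) r)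

/-! ### Existence and uniqueness of the Liouville contraction -/

section Existence

variable (M N) (ħ : ℂ)

theorem superRTTInv_tShift (c : ℂ) :
    SuperRTTInv (parity M N) c ħ (tShift M N ħ c) (tInvMatrix M N ħ) :=
  (superRTT_tShift_tMatrix c).inv (tMatrix_mul_tInvMatrix M N ħ) (tInvMatrix_mul_tMatrix M N ħ)

theorem weaklyContinuous_tShift (i j : Fin (M + N)) :
    WeaklyContinuous fun c => tShift M N ħ c i j := WeaklyContinuous.shift _

theorem weaklyContinuous_tShift_mul (i j : Fin (M + N)) :
    WeaklyContinuous fun c => (tShift M N ħ c * tInvMatrix M N ħ) i j := by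
  simp only [Matrix.mul_apply]
  exact .sum fun k _ => (weaklyContinuous_tShift M N ħ i k).mul_const _

theorem weaklyContinuous_mul_tShift (i j : Fin (M + N)) :
    WeaklyContinuous fun c => (tInvMatrix M N ħ * tShift M N ħ c) i j := by
  simp only [Matrix.mul_apply]
  exact .sum fun k _ => (weaklyContinuous_tShift M N ħ k j).const_mul _

/-- The factor `c - ħ (M - N)` in `smul_supertrace_sub` can be divided out except at one value of
`c`, which continuity covers. -/
theorem supertrace_tShift_mul (c : ℂ) :
    supertrace (parity M N) (tShift M N ħ c * tInvMatrix M N ħ) =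
      supertrace (parity M N) (tInvMatrix M N ħ * tShift M N ħ c) := by
  have hne {c : ℂ} (hc : c ≠ ħ * ((M : ℂ) - N)) :
      supertrace (parity M N) (tShift M N ħ c * tInvMatrix M N ħ)
        - supertrace (parity M N) (tInvMatrix M N ħ * tShift M N ħ c) = 0 := by
    have h := (superRTTInv_tShift M N ħ c).smul_supertrace_sub
    rw [superdim_parity] at h
    exact (smul_eq_zero.1 h).resolve_left (sub_ne_zero.2 hc)
  rw [← sub_eq_zero]
  by_cases hc : c = ħ * ((M : ℂ) - N)
  · subst hc
    have hw : WeaklyContinuous fun c =>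
        supertrace (parity M N) (tShift M N ħ c * tInvMatrix M N ħ)
          - supertrace (parity M N) (tInvMatrix M N ħ * tShift M N ħ c) :=
      .sub (.sum fun k _ => .const_mul _ (weaklyContinuous_tShift_mul M N ħ k k))
        (.sum fun k _ => .const_mul _ (weaklyContinuous_mul_tShift M N ħ k k))
    ext r
    exact (Submodule.mem_bot ℂ).1 (hw.coeff_mem (S := ⊥)
      (fun c hc r => by rw [hne hc]; exact map_zero _) r)
  · exact hne hc

theorem weaklyContinuous_leftContraction (i j : Fin (M + N)) : WeaklyContinuous fun c =>
    leftContraction (parity M N) (tShift M N ħ c) (tInvMatrix M N ħ) i j :=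
  .sum fun k _ => .const_mul _ ((weaklyContinuous_tShift M N ħ k j).mul_const _)

theorem weaklyContinuous_rightContraction (i j : Fin (M + N)) : WeaklyContinuous fun c =>
    rightContraction (parity M N) (tShift M N ħ c) (tInvMatrix M N ħ) i j :=
  .sum fun k _ => .const_mul _ ((weaklyContinuous_tShift M N ħ i k).const_mul _)

/-- The supertrace term is absent off the diagonal and cancels in a difference of diagonal entries.
What remains has the factor `c - ħ (M - N)`, and the product with T⁻¹ contributes 0 at `c = 0`. -/
theorem rightContraction_eq (i₀ i j : Fin (M + N)) :
    rightContraction (parity M N) (tShift M N ħ (ħ * ((M : ℂ) - N))) (tInvMatrix M N ħ) i j =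
      if i = j then rightContraction (parity M N) (tShift M N ħ (ħ * ((M : ℂ) - N)))
        (tInvMatrix M N ħ) i₀ i₀ else 0 := by
  have h (c : ℂ) := (superRTTInv_tShift M N ħ c).smul_rightContraction
  simp only [superdim_parity] at h
  split_ifs with hij
  · subst hij
    rw [← sub_eq_zero]
    refine WeaklyContinuous.eq_zero_of_smul_eq (G := fun c => _ - _)
      (.sub (weaklyContinuous_rightContraction M N ħ i i)
        (weaklyContinuous_rightContraction M N ħ i₀ i₀))
      (.sub (weaklyContinuous_tShift_mul M N ħ i i) (weaklyContinuous_tShift_mul M N ħ i₀ i₀))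
      (fun c => ?_) ?_
    · rw [smul_sub, h, h, if_pos rfl, if_pos rfl]
      module
    · simp [tShift_zero, tMatrix_mul_tInvMatrix]
  · refine WeaklyContinuous.eq_zero_of_smul_eq (weaklyContinuous_rightContraction M N ħ i j)
      (weaklyContinuous_tShift_mul M N ħ i j) (fun c => ?_) ?_
    · rw [h, if_neg hij, smul_zero, add_zero]
    · simp [tShift_zero, tMatrix_mul_tInvMatrix, hij]

/-- Left and right diagonal contractions can be subtracted because their supertrace terms agree by
`supertrace_tShift_mul`. -/
theorem leftContraction_eq (i₀ i j : Fin (M + N)) :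
    leftContraction (parity M N) (tShift M N ħ (ħ * ((M : ℂ) - N))) (tInvMatrix M N ħ) i j =
      if i = j then rightContraction (parity M N) (tShift M N ħ (ħ * ((M : ℂ) - N)))
        (tInvMatrix M N ħ) i₀ i₀ else 0 := by
  have h (c : ℂ) := (superRTTInv_tShift M N ħ c).smul_rightContraction
  have h' (c : ℂ) := (superRTTInv_tShift M N ħ c).smul_leftContraction
  simp only [superdim_parity] at h h'
  split_ifs with hij
  · subst hij
    rw [← sub_eq_zero]
    refine WeaklyContinuous.eq_zero_of_smul_eq (G := fun c => _ - _)
      (.sub (weaklyContinuous_leftContraction M N ħ i i)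
        (weaklyContinuous_rightContraction M N ħ i₀ i₀))
      (.sub (weaklyContinuous_mul_tShift M N ħ i i) (weaklyContinuous_tShift_mul M N ħ i₀ i₀))
      (fun c => ?_) ?_
    · rw [smul_sub, h, h', if_pos rfl, if_pos rfl, supertrace_tShift_mul]
      module
    · simp [tShift_zero, tMatrix_mul_tInvMatrix, tInvMatrix_mul_tMatrix]
  · refine WeaklyContinuous.eq_zero_of_smul_eq (weaklyContinuous_leftContraction M N ħ i j)
      (weaklyContinuous_mul_tShift M N ħ i j) (fun c => ?_) ?_
    · rw [h', if_neg hij, smul_zero, add_zero]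
    · simp [tShift_zero, tInvMatrix_mul_tMatrix, hij]

variable {ħ}

theorem existsUnique_isLiouvilleContraction (hMN : 0 < M + N) (hħ : ħ ≠ 0) :
    ∃! Z : (SuperYangian M N)⟦X⟧, IsLiouvilleContraction M N ħ Z := by
  let i₀ : Fin (M + N) := ⟨0, hMN⟩
  refine ⟨rightContraction (parity M N) (tShift M N ħ (ħ * ((M : ℂ) - N)))
    (tInvMatrix M N ħ) i₀ i₀, ⟨coeff_mem_center hħ (rightContraction_eq M N ħ i₀),
      leftContraction_eq M N ħ i₀, rightContraction_eq M N ħ i₀⟩, fun Z hZ => ?_⟩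
  have := hZ.right i₀ i₀
  rw [if_pos rfl] at this
  exact this.symm

end Existence

/-! ### Series annihilating a vector or having it as an eigenvector -/

section Eigenvectors

variable {V : Type*} [AddCommGroup V] [Module ℂ V] [Module (SuperYangian M N) V]

/-- The left ideal of the series all of whose coefficients annihilate `v`. -/
def annSeries (v : V) : Submodule (SuperYangian M N)⟦X⟧ (SuperYangian M N)⟦X⟧ where
  carrier := {F | ∀ n, coeff n F • v = 0}
  add_mem' hF hG n := by rw [map_add, add_smul, hF, hG, add_zero]
  zero_mem' n := by rw [map_zero, zero_smul]
  smul_mem' F G hG n := by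
    rw [smul_eq_mul, coeff_mul, Finset.sum_smul]
    exact Finset.sum_eq_zero fun ij _ => by rw [mul_smul, hG, smul_zero]

omit [Module ℂ V] in
theorem mul_mem_annSeries {v : V} (F : (SuperYangian M N)⟦X⟧) {G : (SuperYangian M N)⟦X⟧}
    (hG : G ∈ annSeries v) : F * G ∈ annSeries v := (annSeries v).smul_mem F hG

variable [IsScalarTower ℂ (SuperYangian M N) V]

/-- The elements of the super-Yangian that annihilate `v`, as a complex subspace. -/
def annihilator (v : V) : Submodule ℂ (SuperYangian M N) :=
  LinearMap.ker ((LinearMap.toSpanSingleton (SuperYangian M N) V v).restrictScalars ℂ)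

theorem mem_annSeries_iff {v : V} {F : (SuperYangian M N)⟦X⟧} :
    F ∈ annSeries v ↔ ∀ n, coeff n F ∈ annihilator v := Iff.rfl

theorem complex_smul_mem_annSeries {v : V} (c : ℂ) {F : (SuperYangian M N)⟦X⟧}
    (hF : F ∈ annSeries v) : c • F ∈ annSeries v := by
  rw [mem_annSeries_iff] at hF ⊢
  intro n
  rw [coeff_smul]
  exact Submodule.smul_mem _ c (hF n)

/-- The elements of the super-Yangian that have `v` as an eigenvector, as a complex subspace. -/
def eigenSpace (v : V) : Submodule ℂ (SuperYangian M N) :=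
  (Submodule.span ℂ {v}).comap
    ((LinearMap.toSpanSingleton (SuperYangian M N) V v).restrictScalars ℂ)

theorem mem_eigenSpace {v : V} {y : SuperYangian M N} :
    y ∈ eigenSpace v ↔ ∃ c : ℂ, c • v = y • v := Submodule.mem_span_singleton

/-- The algebra of the series all of whose coefficients have `v` as an eigenvector. -/
def eigenSeries (v : V) : Subalgebra ℂ (SuperYangian M N)⟦X⟧ where
  carrier := {F | ∀ n, coeff n F ∈ eigenSpace v}
  add_mem' hF hG n := by rw [map_add]; exact Submodule.add_mem _ (hF n) (hG n)
  mul_mem' hF hG n := by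
    rw [coeff_mul]
    refine Submodule.sum_mem _ fun ij _ => ?_
    obtain ⟨f, hf⟩ := mem_eigenSpace.1 (hF ij.1)
    obtain ⟨g, hg⟩ := mem_eigenSpace.1 (hG ij.2)
    exact mem_eigenSpace.2 ⟨g * f, by rw [mul_smul, mul_smul, ← hg, hf, smul_algebra_smul_comm]⟩
  algebraMap_mem' c n := by
    rw [PowerSeries.algebraMap_apply, coeff_C]
    split_ifs
    · exact mem_eigenSpace.2 ⟨c, (algebraMap_smul _ c v).symm⟩
    · exact Submodule.zero_mem _

theorem annSeries_le_eigenSeries {v : V} {F : (SuperYangian M N)⟦X⟧} (hF : F ∈ annSeries v) :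
    F ∈ eigenSeries v := fun n => mem_eigenSpace.2 ⟨0, by rw [zero_smul, hF]⟩

theorem mem_eigenSeries_iff {v : V} {F : (SuperYangian M N)⟦X⟧} :
    F ∈ eigenSeries v ↔ ∃ f, ActsBy F v f := by
  constructor
  · intro h
    choose f hf using fun n => mem_eigenSpace.1 (h n)
    exact ⟨PowerSeries.mk f, fun n => by rw [coeff_mk, hf]⟩
  · rintro ⟨f, hf⟩ n
    exact mem_eigenSpace.2 ⟨_, (hf n).symm⟩

omit [IsScalarTower ℂ (SuperYangian M N) V] in
theorem actsBy_zero_iff {v : V} {F : (SuperYangian M N)⟦X⟧} :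
    ActsBy F v 0 ↔ F ∈ annSeries v :=
  forall_congr' fun n => by rw [map_zero, zero_smul]

theorem ActsBy.mul {v : V} {F G : (SuperYangian M N)⟦X⟧} {f g : ℂ⟦X⟧} (hF : ActsBy F v f)
    (hG : ActsBy G v g) : ActsBy (F * G) v (f * g) := fun n => by
  rw [coeff_mul, coeff_mul, Finset.sum_smul, Finset.sum_smul]
  refine Finset.sum_congr rfl fun ij _ => ?_
  rw [mul_smul, hG, smul_algebra_smul_comm, hF, smul_smul, mul_comm]

omit [IsScalarTower ℂ (SuperYangian M N) V] in
theorem ActsBy.sub {v : V} {F G : (SuperYangian M N)⟦X⟧} {f g : ℂ⟦X⟧} (hF : ActsBy F v f)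
    (hG : ActsBy G v g) : ActsBy (F - G) v (f - g) := fun n => by
  rw [map_sub, map_sub, sub_smul, sub_smul, hF, hG]

theorem ActsBy.shift {v : V} {F : (SuperYangian M N)⟦X⟧} {f : ℂ⟦X⟧} (hF : ActsBy F v f) (c : ℂ) :
    ActsBy (shift c F) v (shift c f) := fun n => by
  rw [SuperYangian.shift, SuperYangian.shift, coeff_mk, coeff_mk, Finset.sum_smul, Finset.sum_smul]
  refine Finset.sum_congr rfl fun k _ => ?_
  rw [smul_assoc, hF, smul_assoc]

theorem actsBy_map (v : V) (f : ℂ⟦X⟧) :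
    ActsBy (PowerSeries.map (algebraMap ℂ (SuperYangian M N)) f) v f := fun n => by
  rw [coeff_map, algebraMap_smul]

theorem ActsBy.sub_map_mem {v : V} {F : (SuperYangian M N)⟦X⟧} {f : ℂ⟦X⟧} (hF : ActsBy F v f) :
    F - PowerSeries.map (algebraMap ℂ (SuperYangian M N)) f ∈ annSeries v := by
  rw [← actsBy_zero_iff, ← sub_self f]
  exact hF.sub (actsBy_map v f)

omit [IsScalarTower ℂ (SuperYangian M N) V] in
theorem ActsBy.unique {v : V} (hv : v ≠ 0) {F G : (SuperYangian M N)⟦X⟧} {f g : ℂ⟦X⟧}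
    (hF : ActsBy F v f) (hG : ActsBy G v g) (h : F - G ∈ annSeries v) : f = g := by
  ext n
  have h2 := h n
  rw [map_sub, sub_smul, hF, hG, ← sub_smul] at h2
  exact sub_eq_zero.1 ((smul_eq_zero.1 h2).resolve_right hv)

theorem mul_map_mul_map_inv {g : ℂ⟦X⟧} (hg : constantCoeff g = 1) (F : (SuperYangian M N)⟦X⟧) :
    PowerSeries.map (algebraMap ℂ (SuperYangian M N)) g⁻¹ *
      (F * PowerSeries.map (algebraMap ℂ (SuperYangian M N)) g) = F := by
  rw [← map_algebraMap_mul_comm, ← mul_assoc, ← map_mul,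
    PowerSeries.inv_mul_cancel _ (by rw [hg]; exact one_ne_zero), map_one, one_mul]

/-- Modulo the annihilator `G` may be replaced by the central scalar series `g`, which is
invertible. -/
theorem ActsBy.mem_annSeries_of_mul_mem {v : V} {F G : (SuperYangian M N)⟦X⟧} {g : ℂ⟦X⟧}
    (hG : ActsBy G v g) (hg : constantCoeff g = 1) (h : F * G ∈ annSeries v) :
    F ∈ annSeries v := by
  have h1 := (annSeries v).sub_mem h (mul_mem_annSeries F hG.sub_map_mem)
  rw [← mul_sub, sub_sub_cancel] at h1
  rw [← mul_map_mul_map_inv hg F]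
  exact mul_mem_annSeries _ h1

theorem ActsBy.mem_eigenSeries_of_mul_mem {v : V} {F G : (SuperYangian M N)⟦X⟧} {g : ℂ⟦X⟧}
    (hG : ActsBy G v g) (hg : constantCoeff g = 1) (h : F * G ∈ eigenSeries v) :
    F ∈ eigenSeries v := by
  have h1 := (eigenSeries v).sub_mem h
    (annSeries_le_eigenSeries (mul_mem_annSeries F hG.sub_map_mem))
  rw [← mul_sub, sub_sub_cancel] at h1
  rw [← mul_map_mul_map_inv hg F]
  exact (eigenSeries v).mul_mem (mem_eigenSeries_iff.2 ⟨_, actsBy_map v _⟩) h1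

end Eigenvectors

/-! ### Action of T⁻¹ on a highest weight vector -/

section HighestWeight

variable {ħ : ℂ} {V : Type*} [AddCommGroup V] [Module ℂ V] [Module (SuperYangian M N) V]
  {v : V} {lam : Fin (M + N) → ℂ⟦X⟧}

/-- The superdimension of the span of the indices before `k`. -/
def partialSuperdim (M N : ℕ) (k : Fin (M + N)) : ℂ := ∑ s ∈ Finset.Iio k, (-1) ^ parity M N s

variable [IsScalarTower ℂ (SuperYangian M N) V]

theorem IsHighestWeightVector.actsBy_tShift (h : IsHighestWeightVector ħ v lam) (c : ℂ)
    (a : Fin (M + N)) : ActsBy (tShift M N ħ c a a) v (shift c (lam a)) :=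
  ActsBy.shift (h.diagonal a) c

omit [IsScalarTower ℂ (SuperYangian M N) V] in
theorem IsHighestWeightVector.constantCoeff_shift (h : IsHighestWeightVector ħ v lam) (c : ℂ)
    (a : Fin (M + N)) : PowerSeries.constantCoeff (SuperYangian.shift c (lam a)) = 1 := by
  rw [SuperYangian.constantCoeff_shift, h.constantCoeff]

theorem IsHighestWeightVector.tShift_mem (h : IsHighestWeightVector ħ v lam) (c : ℂ)
    {a b : Fin (M + N)} (hab : b < a) : tShift M N ħ c a b ∈ annSeries v := by
  have h0 : shift c (0 : ℂ⟦X⟧) = 0 := by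
    rw [← zero_smul ℂ (0 : ℂ⟦X⟧), shift_smul, zero_smul, zero_smul]
  rw [← actsBy_zero_iff, ← h0]
  exact ActsBy.shift (h.lower a b hab) c

theorem neg_one_pow_mul_self (n : ℕ) : (-1 : ℂ) ^ n * (-1) ^ n = 1 := by
  rw [← mul_pow]; simp

omit [Module ℂ V] [IsScalarTower ℂ (SuperYangian M N) V] in
theorem sum_sub_sum_Iio_mem {F : Fin (M + N) → (SuperYangian M N)⟦X⟧} {k : Fin (M + N)}
    (hF : ∀ s, k < s → F s ∈ annSeries v) :
    ∑ s, F s - (∑ s ∈ Finset.Iio k, F s + F k) ∈ annSeries v := by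
  have hsplit : ∑ s, F s = ∑ s ∈ Finset.Iic k, F s + ∑ s ∈ Finset.Ioi k, F s := by
    rw [← Finset.sum_union]
    · congr 1
      ext s
      simp [le_or_gt]
    · rw [Finset.disjoint_left]
      intro s hs hs'
      exact absurd (Finset.mem_Iic.1 hs) (not_le.2 (Finset.mem_Ioi.1 hs'))
  have hIic : ∑ s ∈ Finset.Iic k, F s = ∑ s ∈ Finset.Iio k, F s + F k := by
    rw [← Finset.Iio_insert, Finset.sum_insert (by simp), add_comm]
  rw [hsplit, hIic, add_sub_cancel_left]
  exact Submodule.sum_mem _ fun s hs => hF s (Finset.mem_Ioi.1 hs)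

/-- In the matrix product, terms with `s > b` end in a lower entry of T and kill `v`. Terms with `s
< b` are reordered so that T⁻¹_{as}, which kills `v` by assumption, comes last; only the RTT
corrections survive. -/
theorem IsHighestWeightVector.smul_mul_tShift_mem (h : IsHighestWeightVector ħ v lam)
    {a b : Fin (M + N)} (ha : ∀ s < b, tInvMatrix M N ħ a s ∈ annSeries v) (c : ℂ) :
    c • (tInvMatrix M N ħ * tShift M N ħ c) a b - c • (tInvMatrix M N ħ a b * tShift M N ħ c b b)
      - ∑ s ∈ Finset.Iio b, (ħ * (-1) ^ parity M N s) • ((tInvMatrix M N ħ * tShift M N ħ c) a b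
        - if a = b then (tShift M N ħ c * tInvMatrix M N ħ) s s else 0) ∈ annSeries v := by
  have h1 := complex_smul_mem_annSeries c (sum_sub_sum_Iio_mem (v := v)
    (F := fun s => tInvMatrix M N ħ a s * tShift M N ħ c s b) (k := b)
    fun s hs => mul_mem_annSeries _ (h.tShift_mem c hs))
  rw [← Matrix.mul_apply] at h1
  have h2 : ∑ s ∈ Finset.Iio b, (c • (tInvMatrix M N ħ a s * tShift M N ħ c s b)
      - (ħ * (-1) ^ parity M N s) • ((tInvMatrix M N ħ * tShift M N ħ c) a b
        - if a = b then (tShift M N ħ c * tInvMatrix M N ħ) s s else 0)) ∈ annSeries v := by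
    refine Submodule.sum_mem _ fun s hs => ?_
    have hr := superRTTInv_tShift M N ħ c s b a s
    have hm := mul_mem_annSeries (tShift M N ħ c s b) (ha s (Finset.mem_Iio.1 hs))
    have hsign : (-1 : ℂ) ^ ((parity M N s + parity M N b) * (parity M N a + parity M N s)) *
        (-1) ^ (parity M N s * parity M N b + parity M N s * parity M N a
          + parity M N b * parity M N a) = (-1) ^ parity M N s := by
      rw [← pow_add]
      apply neg_one_pow_eq_of_even_iff
      simp only [Nat.even_add, Nat.even_mul]
      tauto
    have hsq := neg_one_pow_mul_self
      ((parity M N s + parity M N b) * (parity M N a + parity M N s))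
    generalize (-1 : ℂ) ^ ((parity M N s + parity M N b) * (parity M N a + parity M N s)) = ε at *
    have := complex_smul_mem_annSeries (ε * c) hm
    convert this using 1
    rw [← hsign, if_pos rfl] at *
    have e1 : c • (tInvMatrix M N ħ a s * tShift M N ħ c s b) =
        (ε * c) • (tShift M N ħ c s b * tInvMatrix M N ħ a s) - ε • (c •
          (tShift M N ħ c s b * tInvMatrix M N ħ a s
            - ε • (tInvMatrix M N ħ a s * tShift M N ħ c s b))) := by
      rw [smul_sub, smul_sub, smul_smul, smul_smul, smul_smul, sub_sub_cancel,
        mul_right_comm, hsq, one_mul]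
    rw [e1, hr]
    simp only [eq_comm (a := b)]
    module
  rw [Finset.sum_sub_distrib] at h2
  have h3 := Submodule.add_mem _ h1 h2
  convert h3 using 1
  rw [← Finset.smul_sum]
  module

theorem IsHighestWeightVector.smul_tShift_mul_mem (h : IsHighestWeightVector ħ v lam)
    {k : Fin (M + N)} (hk : ∀ s, k < s → tInvMatrix M N ħ s k ∈ annSeries v) (c : ℂ) :
    c • (tShift M N ħ c * tInvMatrix M N ħ) k k - c • (tShift M N ħ c k k * tInvMatrix M N ħ k k)
      - ∑ s ∈ Finset.Iio k, (ħ * (-1) ^ parity M N s) • ((tShift M N ħ c * tInvMatrix M N ħ) k k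
        - (tInvMatrix M N ħ * tShift M N ħ c) s s) ∈ annSeries v := by
  have h1 := complex_smul_mem_annSeries c (sum_sub_sum_Iio_mem (v := v)
    (F := fun s => tShift M N ħ c k s * tInvMatrix M N ħ s k) (k := k)
    fun s hs => mul_mem_annSeries _ (hk s hs))
  rw [← Matrix.mul_apply] at h1
  have h2 : ∑ s ∈ Finset.Iio k, (c • (tShift M N ħ c k s * tInvMatrix M N ħ s k)
      - (ħ * (-1) ^ parity M N s) • ((tShift M N ħ c * tInvMatrix M N ħ) k k
        - (tInvMatrix M N ħ * tShift M N ħ c) s s)) ∈ annSeries v := by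
    refine Submodule.sum_mem _ fun s hs => ?_
    have hr := superRTTInv_tShift M N ħ c k s s k
    have hm := mul_mem_annSeries (tInvMatrix M N ħ s k) (h.tShift_mem c (Finset.mem_Iio.1 hs))
    have hsign : (-1 : ℂ) ^ (parity M N k * parity M N s + parity M N k * parity M N s
          + parity M N s * parity M N s) = (-1) ^ parity M N s := by
      apply neg_one_pow_eq_of_even_iff
      simp only [Nat.even_add, Nat.even_mul]
      tauto
    rw [hsign, if_pos rfl, if_pos rfl, smul_sub c, sub_eq_iff_eq_add] at hr
    rw [hr, add_sub_cancel_left]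
    exact complex_smul_mem_annSeries _ (complex_smul_mem_annSeries _ hm)
  rw [Finset.sum_sub_distrib] at h2
  have h3 := Submodule.add_mem _ h1 h2
  convert h3 using 1
  rw [← Finset.smul_sum]
  module

/-- Modulo the annihilator, `c` T⁻¹_{ab}(u)T_{bb}(u + c) equals `c - ħ d_b` times an entry that
vanishes at `c = 0`. At `c = ħ d_b` the product kills `v`, and T_{bb} acts there by an invertible
series. -/
theorem IsHighestWeightVector.tInvMatrix_mem (h : IsHighestWeightVector ħ v lam)
    {a b : Fin (M + N)} (hab : b < a) : tInvMatrix M N ħ a b ∈ annSeries v := by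
  induction b using WellFoundedLT.induction generalizing a with
  | ind b ih =>
    refine (h.actsBy_tShift (ħ * partialSuperdim M N b) b).mem_annSeries_of_mul_mem
      (h.constantCoeff_shift _ b) ?_
    rw [mem_annSeries_iff]
    refine WeaklyContinuous.coeff_mem_of_smul_sub
      ((weaklyContinuous_tShift M N ħ b b).const_mul (tInvMatrix M N ħ a b))
      (weaklyContinuous_mul_tShift M N ħ a b) (fun c => ?_) (fun r => ?_)
    · rw [← mem_annSeries_iff, ← neg_mem_iff]
      convert h.smul_mul_tShift_mem (a := a) (b := b) (fun s hs => ih s hs (hs.trans hab)) c using 1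
      simp only [if_neg hab.ne', sub_zero]
      rw [← Finset.sum_smul, ← Finset.mul_sum, partialSuperdim]
      module
    · simp [tShift_zero, tInvMatrix_mul_tMatrix, Matrix.one_apply_ne hab.ne']

theorem IsHighestWeightVector.smul_mul_tShift_self_mem (h : IsHighestWeightVector ħ v lam)
    (k : Fin (M + N)) (c : ℂ) :
    c • (tInvMatrix M N ħ k k * tShift M N ħ c k k)
      - ((c - ħ * partialSuperdim M N k) • (tInvMatrix M N ħ * tShift M N ħ c) k k
        + ∑ s ∈ Finset.Iio k, (ħ * (-1) ^ parity M N s) •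
          (tShift M N ħ c * tInvMatrix M N ħ) s s) ∈ annSeries v := by
  rw [← neg_mem_iff]
  convert h.smul_mul_tShift_mem (a := k) (b := k) (fun s hs => h.tInvMatrix_mem hs) c using 1
  simp only [if_true, smul_sub]
  rw [Finset.sum_sub_distrib, ← Finset.sum_smul, ← Finset.mul_sum, partialSuperdim]
  module

/-- The three claims are proved together because the relations at `k` involve the diagonal entries
of both products at all `s < k`. -/
theorem IsHighestWeightVector.mem_eigenSeries (h : IsHighestWeightVector ħ v lam)
    (k : Fin (M + N)) : tInvMatrix M N ħ k k ∈ eigenSeries v ∧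
      ∀ c, (tInvMatrix M N ħ * tShift M N ħ c) k k ∈ eigenSeries v ∧
        (tShift M N ħ c * tInvMatrix M N ħ) k k ∈ eigenSeries v := by
  induction k using WellFoundedLT.induction with
  | ind k ih =>
    have hG (c : ℂ) : c • (tInvMatrix M N ħ k k * tShift M N ħ c k k)
        - (c - ħ * partialSuperdim M N k) • (tInvMatrix M N ħ * tShift M N ħ c) k k
          ∈ eigenSeries v := by
      have hs : ∑ s ∈ Finset.Iio k, (ħ * (-1) ^ parity M N s) •
          (tShift M N ħ c * tInvMatrix M N ħ) s s ∈ eigenSeries v :=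
        sum_mem fun s hs => Subalgebra.smul_mem _ ((ih s (Finset.mem_Iio.1 hs)).2 c).2 _
      have := add_mem (annSeries_le_eigenSeries (h.smul_mul_tShift_self_mem k c)) hs
      rwa [← sub_sub, sub_add_cancel] at this
    have hT (c : ℂ) : tShift M N ħ c k k ∈ eigenSeries v :=
      mem_eigenSeries_iff.2 ⟨_, h.actsBy_tShift c k⟩
    have hI : tInvMatrix M N ħ k k ∈ eigenSeries v := by
      refine (h.actsBy_tShift (ħ * partialSuperdim M N k) k).mem_eigenSeries_of_mul_mem
        (h.constantCoeff_shift _ k) fun r => ?_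
      refine WeaklyContinuous.coeff_mem_of_smul_sub
        ((weaklyContinuous_tShift M N ħ k k).const_mul (tInvMatrix M N ħ k k))
        (weaklyContinuous_mul_tShift M N ħ k k) hG (fun r => ?_) r
      rw [tShift_zero, tInvMatrix_mul_tMatrix, Matrix.one_apply_eq]
      exact one_mem (eigenSeries v) r
    -- Division by `c - ħ d_k` for generic `c`, then continuity at the exceptional value.
    have hdiv {F : ℂ → (SuperYangian M N)⟦X⟧} (hF : WeaklyContinuous F)
        (hc : ∀ c, (c - ħ * partialSuperdim M N k) • F c ∈ eigenSeries v) (c : ℂ) :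
        F c ∈ eigenSeries v := by
      have hne (c) (h : c ≠ ħ * partialSuperdim M N k) : F c ∈ eigenSeries v := by
        have := Subalgebra.smul_mem _ (hc c) (c - ħ * partialSuperdim M N k)⁻¹
        rwa [smul_smul, inv_mul_cancel₀ (sub_ne_zero.2 h), one_smul] at this
      by_cases h : c = ħ * partialSuperdim M N k
      · subst h
        exact fun r => hF.coeff_mem hne r
      · exact hne c h
    refine ⟨hI, fun c => ⟨hdiv (weaklyContinuous_mul_tShift M N ħ k k) (fun c => ?_) c,
      hdiv (weaklyContinuous_tShift_mul M N ħ k k) (fun c => ?_) c⟩⟩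
    · have := sub_mem (Subalgebra.smul_mem _ (mul_mem hI (hT c)) c) (hG c)
      rwa [sub_sub_cancel] at this
    · have h1 := annSeries_le_eigenSeries
        (h.smul_tShift_mul_mem (k := k) (fun s hs => h.tInvMatrix_mem hs) c)
      have h2 : ∑ s ∈ Finset.Iio k, (ħ * (-1) ^ parity M N s) •
          (tInvMatrix M N ħ * tShift M N ħ c) s s ∈ eigenSeries v :=
        sum_mem fun s hs => Subalgebra.smul_mem _ ((ih s (Finset.mem_Iio.1 hs)).2 c).1 _
      have h3 := sub_mem (add_mem h1 (Subalgebra.smul_mem _ (mul_mem (hT c) hI) c)) h2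
      convert h3 using 1
      simp only [smul_sub]
      rw [Finset.sum_sub_distrib, ← Finset.sum_smul, ← Finset.mul_sum, partialSuperdim]
      module

/-- The relation with all four indices equal to `k` writes this difference as a multiple of an
ordinary commutator, which kills `v` because both factors act by scalars. -/
theorem IsHighestWeightVector.mul_tShift_sub_mem (h : IsHighestWeightVector ħ v lam) (hħ : ħ ≠ 0)
    (k : Fin (M + N)) (c : ℂ) : (tShift M N ħ c * tInvMatrix M N ħ) k k
      - (tInvMatrix M N ħ * tShift M N ħ c) k k ∈ annSeries v := by
  obtain ⟨f, hf⟩ := mem_eigenSeries_iff.1 (h.mem_eigenSeries k).1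
  have h1 : tShift M N ħ c k k * tInvMatrix M N ħ k k
      - tInvMatrix M N ħ k k * tShift M N ħ c k k ∈ annSeries v := by
    rw [← actsBy_zero_iff]
    have := ((h.actsBy_tShift c k).mul hf).sub (hf.mul (h.actsBy_tShift c k))
    rwa [mul_comm f, sub_self] at this
  have h2 := superRTTInv_tShift M N ħ c k k k k
  rw [← two_mul, mul_assoc 2, pow_mul, neg_one_sq, one_pow, one_smul, if_pos rfl, if_pos rfl] at h2
  have h3 := complex_smul_mem_annSeries c h1
  rw [h2] at h3
  have hne : ħ * (-1) ^ (parity M N k * parity M N k + parity M N k * parity M N k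
      + parity M N k * parity M N k) ≠ 0 := mul_ne_zero hħ (pow_ne_zero _ (by norm_num))
  have h4 := complex_smul_mem_annSeries (ħ * (-1) ^ (parity M N k * parity M N k
    + parity M N k * parity M N k + parity M N k * parity M N k))⁻¹ h3
  rwa [smul_smul, inv_mul_cancel₀ hne, one_smul] at h4

theorem partialSuperdim_succ {k l : Fin (M + N)} (hkl : (l : ℕ) = k + 1) :
    partialSuperdim M N l = partialSuperdim M N k + (-1) ^ parity M N k := by
  have : Finset.Iio l = insert k (Finset.Iio k) := by
    ext s
    simp only [Finset.mem_Iio, Finset.mem_insert, Fin.lt_def, Fin.ext_iff]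
    omega
  rw [partialSuperdim, this, Finset.sum_insert (by simp), add_comm, partialSuperdim]

/-- Consecutive eigenvalues of the diagonal entries of `T⁻¹(u)`. -/
theorem IsHighestWeightVector.mul_shift_succ (h : IsHighestWeightVector ħ v lam) (hħ : ħ ≠ 0)
    {lam' : Fin (M + N) → ℂ⟦X⟧} (h' : ∀ k, ActsBy (tInvMatrix M N ħ k k) v (lam' k))
    {k l : Fin (M + N)} (hkl : (l : ℕ) = k + 1) :
    lam' l * shift (ħ * partialSuperdim M N l) (lam l) =
      lam' k * shift (ħ * partialSuperdim M N l) (lam k) := by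
  refine ((h' l).mul (h.actsBy_tShift _ l)).unique h.ne_zero
    ((h' k).mul (h.actsBy_tShift _ k)) ?_
  rw [mem_annSeries_iff]
  refine WeaklyContinuous.coeff_mem_of_smul_sub
    (G := fun c => tInvMatrix M N ħ l l * tShift M N ħ c l l
      - tInvMatrix M N ħ k k * tShift M N ħ c k k)
    (H := fun c => (tInvMatrix M N ħ * tShift M N ħ c) l l
      - (tInvMatrix M N ħ * tShift M N ħ c) k k)
    (((weaklyContinuous_tShift M N ħ l l).const_mul _).sub
      ((weaklyContinuous_tShift M N ħ k k).const_mul _))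
    ((weaklyContinuous_mul_tShift M N ħ l l).sub (weaklyContinuous_mul_tShift M N ħ k k))
    (fun c => ?_) (fun r => ?_)
  · rw [← mem_annSeries_iff]
    have hIio : Finset.Iio l = insert k (Finset.Iio k) := by
      ext s
      simp only [Finset.mem_Iio, Finset.mem_insert, Fin.lt_def, Fin.ext_iff]
      omega
    have h1 := h.smul_mul_tShift_self_mem l c
    have h2 := h.smul_mul_tShift_self_mem k c
    -- Trading T T⁻¹ for T⁻¹ T in the extra summand `s = k` changes the factor `c - ħ d_k` into `c -
    -- ħ d_l`, so both entries carry the same factor.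
    have h3 := complex_smul_mem_annSeries (ħ * (-1) ^ parity M N k) (h.mul_tShift_sub_mem hħ k c)
    rw [hIio, Finset.sum_insert (by simp)] at h1
    convert add_mem (sub_mem h1 h2) h3 using 1
    simp only [partialSuperdim_succ hkl]
    module
  · simp [tShift_zero, tInvMatrix_mul_tMatrix]

/-- In the right contraction at the last index `l`, every summand with `k ≠ l` ends in T_{lk} with
`k < l`. -/
theorem IsLiouvilleContraction.sub_mem {Z : (SuperYangian M N)⟦X⟧}
    (hZ : IsLiouvilleContraction M N ħ Z) (h : IsHighestWeightVector ħ v lam) {l : Fin (M + N)}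
    (hl : ∀ k, k ≤ l) : Z - tInvMatrix M N ħ l l * tShift M N ħ (ħ * ((M : ℂ) - N)) l l
      ∈ annSeries v := by
  have h1 := hZ.right l l
  rw [if_pos rfl] at h1
  rw [← h1, ← Finset.add_sum_erase _ _ (Finset.mem_univ l)]
  have hsign : (-1 : (SuperYangian M N)⟦X⟧) ^ ((parity M N l + parity M N l) *
      (parity M N l + parity M N l)) = 1 := by
    rw [← two_mul, mul_assoc 2, pow_mul, neg_one_sq, one_pow]
  rw [hsign, one_mul]
  refine (congrArg (· ∈ annSeries v) (add_sub_cancel_left _ _)).mpr ?_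
  refine Submodule.sum_mem _ fun k hk => mul_mem_annSeries _ (mul_mem_annSeries _ ?_)
  exact h.tShift_mem _ (lt_of_le_of_ne (hl k) (Finset.ne_of_mem_erase hk))

end HighestWeight

/-! ### Solving the recursion for the eigenvalues -/

theorem partialSuperdim_eq (k : Fin (M + N)) :
    partialSuperdim M N k = if (k : ℕ) ≤ M then ((k : ℕ) : ℂ) else 2 * M - (k : ℕ) := by
  obtain ⟨n, hn⟩ := k
  induction n with
  | zero =>
    rw [partialSuperdim, Finset.sum_eq_zero]
    · simp
    · intro s hs
      exact absurd (Fin.lt_def.1 (Finset.mem_Iio.1 hs)) (Nat.not_lt_zero _)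
  | succ n ih =>
    rw [partialSuperdim_succ (k := ⟨n, by omega⟩) rfl, ih (by omega)]
    simp only [parity]
    rcases lt_trichotomy n M with h | rfl | h
    · rw [if_pos h.le, if_pos h, if_pos (Nat.succ_le_of_lt h)]
      push_cast
      ring
    · simp
      ring
    · rw [if_neg (by omega), if_neg (by omega), if_neg (by omega)]
      push_cast
      ring

variable {ħ : ℂ} {V : Type*} [AddCommGroup V] [Module ℂ V] [Module (SuperYangian M N) V]
  [IsScalarTower ℂ (SuperYangian M N) V] {v : V} {lam lam' : Fin (M + N) → ℂ⟦X⟧}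

/-- At the first index only one term of the matrix product T⁻¹T acts nontrivially on `v`. -/
theorem IsHighestWeightVector.mul_eq_one (h : IsHighestWeightVector ħ v lam)
    (h' : ∀ k, ActsBy (tInvMatrix M N ħ k k) v (lam' k)) {k : Fin (M + N)} (hk : (k : ℕ) = 0) :
    lam' k * lam k = 1 := by
  have h1 := sum_sub_sum_Iio_mem (v := v) (k := k)
    (F := fun s => tInvMatrix M N ħ k s * tShift M N ħ 0 s k)
    fun s hs => mul_mem_annSeries _ (h.tShift_mem 0 hs)
  have hIio : Finset.Iio k = ∅ := by
    ext s
    simp only [Finset.mem_Iio, Fin.lt_def, Finset.notMem_empty, iff_false]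
    omega
  rw [← Matrix.mul_apply, hIio, Finset.sum_empty, zero_add, tShift_zero, tInvMatrix_mul_tMatrix,
    Matrix.one_apply_eq] at h1
  have h2 := (actsBy_map v 1).unique h.ne_zero ((h' k).mul (h.diagonal k))
    (by rw [map_one]; exact h1)
  exact h2.symm

theorem IsHighestWeightVector.eigenvalue_even (h : IsHighestWeightVector ħ v lam) (hħ : ħ ≠ 0)
    (h' : ∀ k, ActsBy (tInvMatrix M N ħ k k) v (lam' k)) (k : Fin (M + N)) (hk : (k : ℕ) < M) :
    lam' k * ∏ m ∈ Finset.Iic k, shift (ħ * (m : ℕ)) (lam m) =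
      ∏ m ∈ Finset.Iio k, shift (ħ * ((m : ℕ) + 1)) (lam m) := by
  obtain ⟨n, hn⟩ := k
  induction n with
  | zero =>
    have hIio : Finset.Iio (⟨0, hn⟩ : Fin (M + N)) = ∅ := by
      ext s
      simp [Fin.lt_def]
    rw [← Finset.Iio_insert, Finset.prod_insert (by simp), hIio, Finset.prod_empty,
      Finset.prod_empty, mul_one]
    simpa [shift_zero] using h.mul_eq_one h' (k := ⟨0, hn⟩) rfl
  | succ n ih =>
    have hn' : n < M + N := by omega
    have ih := ih hn' ((Nat.lt_succ_self n).trans hk)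
    have hIio : Finset.Iio (⟨n + 1, hn⟩ : Fin (M + N)) = Finset.Iic ⟨n, hn'⟩ := by
      ext s
      simp [Fin.lt_def, Fin.le_def]
    have hs := h.mul_shift_succ hħ h' (k := ⟨n, hn'⟩) (l := ⟨n + 1, hn⟩) rfl
    rw [partialSuperdim_eq, if_pos hk.le] at hs
    rw [← Finset.Iio_insert, Finset.prod_insert (by simp), hIio, ← mul_assoc, hs,
      mul_right_comm, ih, ← Finset.Iio_insert (⟨n, hn'⟩ : Fin (M + N)), Finset.prod_insert (by simp), mul_comm]
    simp

theorem IsHighestWeightVector.eigenvalue_odd (h : IsHighestWeightVector ħ v lam) (hħ : ħ ≠ 0)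
    (h' : ∀ k, ActsBy (tInvMatrix M N ħ k k) v (lam' k)) {Z : (SuperYangian M N)⟦X⟧} {ζ : ℂ⟦X⟧}
    (hZ : IsLiouvilleContraction M N ħ Z) (hζ : ActsBy Z v ζ) (k : Fin (M + N))
    (hk : M ≤ (k : ℕ)) :
    lam' k * ∏ m ∈ Finset.Ici k, shift (ħ * (2 * (M : ℂ) - (m : ℕ) - 1)) (lam m) =
      ζ * ∏ m ∈ Finset.Ioi k, shift (ħ * (2 * (M : ℂ) - (m : ℕ))) (lam m) := by
  obtain ⟨d, hd⟩ : ∃ d, (k : ℕ) + d + 1 = M + N := ⟨M + N - 1 - k, by omega⟩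
  induction d generalizing k with
  | zero =>
    have hIoi : Finset.Ioi k = ∅ := by
      ext s
      simp only [Finset.mem_Ioi, Fin.lt_def, Finset.notMem_empty, iff_false]
      omega
    have hs := hζ.unique h.ne_zero ((h' k).mul (h.actsBy_tShift _ k))
      (hZ.sub_mem h fun s => Fin.le_def.2 (by omega))
    -- The last index is `k = M + N - 1` when counted from 0, so the shift is the one in the
    -- Liouville contraction.
    have hc : 2 * (M : ℂ) - (k : ℕ) - 1 = M - N := by
      have : ((k : ℕ) : ℂ) + 1 = M + N := by exact_mod_cast hd
      linear_combination -this
    rw [← Finset.Ioi_insert, Finset.prod_insert (by simp), hIoi, Finset.prod_empty,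
      Finset.prod_empty, mul_one, mul_one, hc, hs]
  | succ d ih =>
    let l : Fin (M + N) := ⟨k + 1, by omega⟩
    have ih := ih l (by simp only [l]; omega) (by simp only [l]; omega)
    have hIoi : Finset.Ioi k = Finset.Ici l := by
      ext s
      simp only [Finset.mem_Ioi, Finset.mem_Ici, Fin.lt_def, Fin.le_def, l]
      omega
    have hs := h.mul_shift_succ hħ h' (k := k) (l := l) rfl
    rw [partialSuperdim_eq, if_neg (by simp only [l]; omega)] at hs
    have hc : 2 * (M : ℂ) - (k : ℕ) - 1 = 2 * M - (l : ℕ) := by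
      simp only [l]
      push_cast
      ring
    rw [← Finset.Ioi_insert, Finset.prod_insert (by simp), hIoi, hc, ← mul_assoc, ← hs,
      mul_right_comm, ih, ← Finset.Ioi_insert l, Finset.prod_insert (by simp)]
    ring

omit [IsScalarTower ℂ (SuperYangian M N) V] in
theorem constantCoeff_prod_shift {s : Finset (Fin (M + N))} {f : Fin (M + N) → ℂ}
    (h : IsHighestWeightVector ħ v lam) :
    PowerSeries.constantCoeff (∏ m ∈ s, shift (f m) (lam m)) ≠ 0 := by
  rw [map_prod, Finset.prod_eq_one fun m _ => h.constantCoeff_shift (f m) m]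
  exact one_ne_zero

end SuperYangian

end

theorem mainTheorem2 (M N : ℕ) (hMN : 0 < M + N) (ħ : ℂ) (hħ : ħ ≠ 0) :
    (∃! Z : (SuperYangian M N)⟦X⟧, SuperYangian.IsLiouvilleContraction M N ħ Z) ∧
    ∀ Z : (SuperYangian M N)⟦X⟧, SuperYangian.IsLiouvilleContraction M N ħ Z →
    ∀ (V : Type*) [AddCommGroup V] [Module ℂ V] [Module (SuperYangian M N) V]
      [IsScalarTower ℂ (SuperYangian M N) V]
      (v : V) (lam : Fin (M + N) → ℂ⟦X⟧),
    SuperYangian.IsHighestWeightVector ħ v lam →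
    (∃ ζ : ℂ⟦X⟧, SuperYangian.ActsBy Z v ζ) ∧
    (∃ lam' : Fin (M + N) → ℂ⟦X⟧, ∀ k,
      SuperYangian.ActsBy (SuperYangian.entry (SuperYangian.Tinv M N ħ) k k) v (lam' k)) ∧
    ∀ (ζ : ℂ⟦X⟧) (lam' : Fin (M + N) → ℂ⟦X⟧),
      SuperYangian.ActsBy Z v ζ →
      (∀ k, SuperYangian.ActsBy (SuperYangian.entry (SuperYangian.Tinv M N ħ) k k) v (lam' k)) →
      -- indices are counted from `0` here: `m : Fin (M + N)` stands for the index `m + 1`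
      (∀ k : Fin (M + N), (k : ℕ) < M →
        lam' k =
          (∏ m ∈ Finset.Iio k, SuperYangian.shift (ħ * ((m : ℕ) + 1)) (lam m)) *
          (∏ m ∈ Finset.Iic k, SuperYangian.shift (ħ * (m : ℕ)) (lam m))⁻¹) ∧
      (∀ k : Fin (M + N), M ≤ (k : ℕ) →
        lam' k = ζ *
          ((∏ m ∈ Finset.Ioi k, SuperYangian.shift (ħ * (2 * (M : ℂ) - (m : ℕ))) (lam m)) *
          (∏ m ∈ Finset.Ici k, SuperYangian.shift (ħ * (2 * (M : ℂ) - (m : ℕ) - 1)) (lam m))⁻¹)) := by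
  refine ⟨SuperYangian.existsUnique_isLiouvilleContraction M N hMN hħ,
    fun Z hZ V _ _ _ _ v lam h => ?_⟩
  have hex : ∃ lam' : Fin (M + N) → ℂ⟦X⟧, ∀ k,
      SuperYangian.ActsBy (SuperYangian.entry (SuperYangian.Tinv M N ħ) k k) v (lam' k) := by
    choose lam' hlam' using fun k =>
      SuperYangian.mem_eigenSeries_iff.1 (h.mem_eigenSeries k).1
    exact ⟨lam', hlam'⟩
  refine ⟨?_, hex, fun ζ lam' hζ h' => ⟨fun k hk => ?_, fun k hk => ?_⟩⟩
  -- At the last index Z agrees on `v` with a product of two series that act by scalars.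
  · let l : Fin (M + N) := ⟨M + N - 1, by omega⟩
    have h1 := SuperYangian.annSeries_le_eigenSeries
      (hZ.sub_mem h (l := l) fun k => Fin.le_def.2 (by simp only [l]; omega))
    have h2 := mul_mem (h.mem_eigenSeries l).1
      (SuperYangian.mem_eigenSeries_iff.2 ⟨_, h.actsBy_tShift (ħ * ((M : ℂ) - N)) l⟩)
    have h3 := add_mem h1 h2
    rw [sub_add_cancel] at h3
    exact SuperYangian.mem_eigenSeries_iff.1 h3
  · rw [PowerSeries.eq_mul_inv_iff_mul_eq (SuperYangian.constantCoeff_prod_shift h)]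
    exact h.eigenvalue_even hħ h' k hk
  · rw [← mul_assoc, PowerSeries.eq_mul_inv_iff_mul_eq (SuperYangian.constantCoeff_prod_shift h)]
    exact h.eigenvalue_odd hħ h' hZ hζ k hk
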